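/- For $n\ge 1$ let $n^\omega$ be the space of infinite sequences over the alphabet $\{0,\dots,n-1\}$, $n^{<\omega}$ the set of finite strings over it, and $\lambda$ the uniform (Lebesgue) product measure on $n^\omega$. A sequence $x\in n^\omega$ is *random* (Martin-Löf random for $\lambda$) if $x\notin\bigcap_i U_i$ for every uniformly $\Sigma^0_1$ sequence $(U_i)_{i\in\omega}$ of subsets of $n^\omega$ with $\lambda(U_i)\le 2^{-i}$ for all $i$. Let $\sigma_0=\epsilon,\sigma_1=0,\sigma_2=1,\sigma_3=00,\dots$ be the length-lexicographic enumeration of $2^{<\omega}$. *Random closed sets.* For $x\in 3^\omega$ let $T_x\subseteq 2^{<\omega}$ be the tree such that $\epsilon\in T_x$ and, whenever $\sigma$ is the $(i+1)$-st element of $T_x$ in the length-lexicographic order, the children of $\sigma$ in $T_x$ are: only $\sigma0$ if $x(i)=0$; only $\sigma1$ if $x(i)=1$; both $\sigma0$ and $\sigma1$ if $x(i)=2$. Let $[T_x]\subseteq 2^\omega$ be its set of infinite paths. A non-empty closed set $C\subseteq 2^\omega$ is a *random closed set* if $C=[T_x]$ for some random $x\in 3^\omega$. *Random continuous functions.* For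 $x\in 3^\omega$ label each non-empty string by $\ell_x(\sigma_i)=x(i-1)$, $i\ge 1$, and let $F_x$ be the partial function from $2^\omega$ to $2^\omega$ for which $F_x(y)$ is the result of removing all $2$'s from the sequence $\ell_x(y\restriction 1),\ell_x(y\restriction 2),\ell_x(y\restriction 3),\dots$ ($F_x(y)$ is undefined if only finitely many $0$'s and $1$'s remain). A partial function $F$ from $2^\omega$ to $2^\omega$, continuous on its domain, is a *random continuous function* if $F=F_x$ for some random $x\in 3^\omega$. Its zero set is $Z_F=\{y\in 2^\omega : F(y)\text{ is defined and } F(y)=0^\omega\}$. **Theorem.** (i) For every random continuous function $F$, if $Z_F\neq\emptyset$ then $Z_F$ is a random closed set. (ii) For every random closed set $C\subseteq 2^\omega$ there is a random continuous function $F$ such that $C=Z_F$. -/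

import Mathlib

open MeasureTheory
open scoped ENNReal

namespace RandomZeros

/-- The space `n^ω` of infinite sequences over the alphabet `{0, …, n-1}`, with the product
topology and the product (Borel) σ-algebra. -/
abbrev Seq (n : ℕ) : Type := ℕ → Fin n

/-- The initial segment `x ↾ k` of length `k`. -/
def prefixOf {n : ℕ} (x : Seq n) (k : ℕ) : List (Fin n) := List.ofFn fun i : Fin k => x i

/-- The basic clopen set of all infinite sequences extending the finite string `σ`. -/
def cylinder {n : ℕ} (σ : List (Fin n)) : Set (Seq n) := {x | prefixOf x σ.length = σ}

/-- The Lebesgue measure on `n^ω`: the product of the uniform measures on `{0, …, n-1}`. -/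
noncomputable def lebesgue (n : ℕ) [NeZero n] : Measure (Seq n) :=
  Measure.infinitePi fun _ : ℕ => (PMF.uniformOfFintype (Fin n)).toMeasure

/-- The `i`-th open set generated by a set `W` of pairs (index, finite string). The uniformly
`Σ⁰₁` sequences of classes are exactly the sequences `openFamily W` with `W` recursively
enumerable. -/
def openFamily {n : ℕ} (W : ℕ × List (Fin n) → Prop) (i : ℕ) : Set (Seq n) :=
  {x | ∃ σ, W (i, σ) ∧ x ∈ cylinder σ}

/-- `W` enumerates a `μ`-Martin-Löf test. -/
def IsMLTest {n : ℕ} (μ : Measure (Seq n)) (W : ℕ × List (Fin n) → Prop) : Prop :=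
  REPred W ∧ ∀ i, μ (openFamily W i) ≤ (2 : ℝ≥0∞)⁻¹ ^ i

/-- The set of `μ`-Martin-Löf random sequences. -/
def MLR {n : ℕ} (μ : Measure (Seq n)) : Set (Seq n) :=
  {x | ∀ W, IsMLTest μ W → x ∉ ⋂ i, openFamily W i}

/-- The position of a binary string in the length-lexicographic enumeration
`σ₀ = ε, σ₁ = 0, σ₂ = 1, σ₃ = 00, …` of `2^{<ω}`; the children of `σ_p` are `σ_{2p+1}`
(append `0`) and `σ_{2p+2}` (append `1`). -/
def strIndex (σ : List (Fin 2)) : ℕ := σ.foldl (fun (p : ℕ) (b : Fin 2) => 2 * p + 1 + (b : ℕ)) 0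

/-- Whether the string `σ_k` belongs to the tree `T_x` coded by `x ∈ 3^ω`. The root does. For
`k = n + 1`, the parent of `σ_k` is `σ_p` with `p = n / 2`, and the last bit of `σ_k` is `n % 2`.
If `σ_p` belongs to the tree and `i` nodes of the tree precede it in the length-lexicographic
order, then the children of `σ_p` in the tree are: only the `0`-child if `x i = 0`, only the
`1`-child if `x i = 1`, both if `x i = 2`. (All nodes of the tree are extendible.) -/
def nodeInTree (x : Seq 3) : ℕ → Bool
  | 0 => true
  | n + 1 =>
    let i := (List.finRange (n / 2)).countP fun m : Fin (n / 2) => nodeInTree x m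
    nodeInTree x (n / 2) && decide ((x i : ℕ) = n % 2 ∨ x i = 2)
  decreasing_by all_goals omega

/-- The tree `T_x ⊆ 2^{<ω}` without dead ends coded by `x ∈ 3^ω`. -/
def codedTree (x : Seq 3) : Set (List (Fin 2)) := {σ | nodeInTree x (strIndex σ) = true}

/-- The set `[T]` of infinite paths through `T`. -/
def paths (T : Set (List (Fin 2))) : Set (Seq 2) := {y | ∀ k, prefixOf y k ∈ T}

/-- Random closed sets. -/
def IsRandomClosedSet (C : Set (Seq 2)) : Prop :=
  C.Nonempty ∧ IsClosed C ∧ ∃ x ∈ MLR (lebesgue 3), C = paths (codedTree x)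

/-- The labeling `ℓ_x` of the non-empty binary strings: `ℓ_x(σ_i) = x (i - 1)` for `i ≥ 1`. -/
def label (x : Seq 3) (σ : List (Fin 2)) : Fin 3 := x (strIndex σ - 1)

/-- The result of removing all `2`s from a sequence `a ∈ 3^ω`; it is defined if and only if
infinitely many `0`s and `1`s remain. -/
noncomputable def removeTwos (a : Seq 3) : Part (Seq 2) where
  Dom := {k | a k ≠ 2}.Infinite
  get h := fun j => (a (Nat.nth (fun k => a k ≠ 2) j)).castLT (by
    have := Nat.nth_mem_of_infinite (p := fun k => a k ≠ 2) h j
    omega)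

/-- The partial function `F_x` on `2^ω` coded by `x ∈ 3^ω`: remove the `2`s from the sequence
`ℓ_x(y ↾ 1), ℓ_x(y ↾ 2), …`. -/
noncomputable def codedFun (x : Seq 3) : Seq 2 →. Seq 2 :=
  fun y => removeTwos fun k => label x (prefixOf y (k + 1))

/-- A partial function is continuous on its domain (with the subspace topology). -/
def IsContinuousPartial (F : Seq 2 →. Seq 2) : Prop :=
  Continuous fun y : F.Dom => F.fn y.1 y.2

/-- Random (partial) continuous functions on `2^ω`. -/
def IsRandomContinuous (F : Seq 2 →. Seq 2) : Prop :=
  IsContinuousPartial F ∧ ∃ x ∈ MLR (lebesgue 3), F = codedFun x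

/-- The set `Z_F` of all `y` such that `F y` is defined and equal to `0^ω`. -/
def zeroSet (F : Seq 2 →. Seq 2) : Set (Seq 2) := {y | (fun _ => 0) ∈ F y}

end RandomZeros

/-!
A random labeling has no branch that is eventually labeled `2`, so the zero set of the function it
codes consists of its survivors, the branches without a label `1`. In a uniform labeling, some
branch survives with probability `p = 1 - (1 - 2 * p / 3) ^ 2`, that is, `p = 3 / 4`, and given
that one does, the extendible nodes form a tree in which the children of each node are, with equal
probability, the left one, the right one, or both: each child is dead with probability
`1 - 2 * p / 3 = 1 / 2`, and both are not. Hence a uniform labeling is obtained from a coin `c`, a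
code `z` of a tree and a sequence `r` of extra symbols: if `c` is true, then the labels on the tree
coded by `z` are drawn from `0` and `2`, while everywhere else the labels are drawn from their
conditional distribution given that no branch survives. This map `couple` preserves measure, and it
computes each prefix of the labeling from prefixes of `z` and `r`. It fails to produce the intended
survivors only if some branch of `r` has an eventual behavior that no random sequence has.

Randomness is carried in both directions. Given a test for `z` and another one for `r`, consider the
labelings such that every preimage has a component covered by its test. By compactness, these form
effectively open sets, hence a test, so a random labeling has a preimage that passes both tests. As
the code of the tree of survivors is unique, a random labeling with survivors has a random code.
Conversely, if `z` is random, then by Markov's inequality the `z` for which a given test covers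
`couple (true, z, r)` for too many `r` make up a test, so for almost every `r` the labeling
`couple (true, z, r)` is random.
-/

namespace RandomZeros

section Prefixes

variable {n : ℕ}

theorem prefixOf_eq_iff {x y : Seq n} {k : ℕ} :
    prefixOf x k = prefixOf y k ↔ ∀ i < k, x i = y i := by
  rw [prefixOf, prefixOf, List.ofFn_inj, funext_iff, Fin.forall_iff]

@[simp] theorem length_prefixOf (x : Seq n) (k : ℕ) : (prefixOf x k).length = k :=
  List.length_ofFn

theorem getD_prefixOf (x : Seq n) {k j : ℕ} (a : Fin n) (h : j < k) :
    (prefixOf x k).getD j a = x j := by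
  rw [List.getD_eq_getElem _ _ (by simpa using h)]
  simp [prefixOf]

theorem take_prefixOf (x : Seq n) {m N : ℕ} (h : m ≤ N) :
    (prefixOf x N).take m = prefixOf x m :=
  List.ext_getElem (by simpa using h) fun i _ _ => by simp [prefixOf]

theorem prefixOf_succ (x : Seq n) (k : ℕ) : prefixOf x (k + 1) = prefixOf x k ++ [x k] := by
  rw [prefixOf, List.ofFn_succ_last]
  rfl

theorem isClopen_setOf_prefixOf (N : ℕ) (P : List (Fin n) → Prop) :
    IsClopen {x : Seq n | P (prefixOf x N)} :=
  (isClopen_discrete {f : Fin N → Fin n | P (List.ofFn f)}).preimage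
    (f := fun (x : Seq n) (i : Fin N) => x i) (by fun_prop)

theorem mem_openFamily {W : ℕ × List (Fin n) → Prop} {i : ℕ} {x : Seq n} :
    x ∈ openFamily W i ↔ ∃ m, W (i, prefixOf x m) := by
  constructor
  · rintro ⟨σ, hσ, hx⟩
    exact ⟨σ.length, by rwa [show prefixOf x σ.length = σ from hx]⟩
  · rintro ⟨m, hm⟩
    exact ⟨_, hm, by simp [cylinder]⟩

theorem isOpen_openFamily (W : ℕ × List (Fin n) → Prop) (i : ℕ) : IsOpen (openFamily W i) := by
  have : openFamily W i = ⋃ m, {x | W (i, prefixOf x m)} := by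
    ext x
    simp [mem_openFamily]
  exact this ▸ isOpen_iUnion fun m => (isClopen_setOf_prefixOf m fun σ => W (i, σ)).isOpen

end Prefixes

section Nodes

/-- The node of the binary tree reached after `k` steps along the branch `y`, as a position in the
length-lexicographic enumeration of strings; see `strIndex_prefixOf`. -/
def node (y : Seq 2) : ℕ → ℕ
  | 0 => 0
  | k + 1 => 2 * node y k + y k + 1

theorem strIndex_prefixOf (y : Seq 2) (k : ℕ) : strIndex (prefixOf y k) = node y k := by
  induction k with
  | zero => simp [prefixOf, strIndex, node]
  | succ k ih =>
    rw [strIndex, prefixOf_succ, List.foldl_append, ← strIndex, ih]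
    simp only [List.foldl_cons, List.foldl_nil, node]
    omega

theorem two_mul_node_add_div_two (y : Seq 2) (k : ℕ) : (2 * node y k + y k) / 2 = node y k := by
  omega

theorem node_congr {y y' : Seq 2} {k : ℕ} (h : ∀ i < k, y i = y' i) : node y k = node y' k := by
  rw [← strIndex_prefixOf, prefixOf_eq_iff.2 h, strIndex_prefixOf]

theorem le_node (y : Seq 2) (k : ℕ) : k ≤ node y k := by
  induction k with
  | zero => simp
  | succ k ih => simp only [node]; omega

theorem node_eq_node_iff {y y' : Seq 2} {k k' : ℕ} :
    node y k = node y' k' ↔ k = k' ∧ ∀ i < k, y i = y' i := by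
  refine ⟨fun h => ?_, fun ⟨hk, h⟩ => hk ▸ node_congr h⟩
  induction k generalizing k' with
  | zero =>
    have := le_node y' k'
    simp only [node] at h
    exact ⟨by omega, by simp⟩
  | succ k ih =>
    rcases k' with _ | k'
    · simp [node] at h
    simp only [node] at h
    obtain ⟨rfl, hlt⟩ := @ih k' (by omega)
    have hnode := node_congr hlt
    exact ⟨rfl, fun i hi => (Nat.lt_succ_iff_lt_or_eq.1 hi).elim (hlt i) (by rintro rfl; omega)⟩

theorem exists_node_eq (n : ℕ) : ∃ y k, node y k = n := by
  induction n using Nat.strong_induction_on with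
  | _ n ih =>
    rcases n with _ | n
    · exact ⟨fun _ => 0, 0, rfl⟩
    obtain ⟨y, k, hk⟩ := ih (n / 2) (by omega)
    refine ⟨Function.update y k ⟨n % 2, by omega⟩, k + 1, ?_⟩
    rw [node, node_congr (y' := y) fun i hi => Function.update_of_ne hi.ne _ _, hk,
      Function.update_self]
    simp only
    omega

theorem node_add_add_one_div (y : Seq 2) (k j : ℕ) :
    (node y (k + j) + 1) / 2 ^ j = node y k + 1 := by
  induction j with
  | zero => simp
  | succ j ih =>
    rw [pow_succ', ← Nat.div_div_eq_div_mul, ← ih, ← add_assoc, node]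
    congr 1
    omega

/-- `Q` is the set of positions of the nodes of a binary tree that contains the root and has no
dead ends. -/
structure IsPrunedTree (Q : ℕ → Prop) : Prop where
  root : Q 0
  parent {n : ℕ} : Q (n + 1) → Q (n / 2)
  child {n : ℕ} : Q n → Q (2 * n + 1) ∨ Q (2 * n + 2)

namespace IsPrunedTree

variable {Q : ℕ → Prop}

theorem node_of_le (hQ : IsPrunedTree Q) {y : Seq 2} {k : ℕ} (hk : Q (node y k)) :
    ∀ j ≤ k, Q (node y j) := by
  induction k with
  | zero => simpa using hk
  | succ k ih =>
    rintro j hj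
    rcases hj.eq_or_lt with rfl | hj
    · exact hk
    · exact ih (two_mul_node_add_div_two y k ▸ hQ.parent hk) j (by omega)

theorem exists_branch (hQ : IsPrunedTree Q) {n : ℕ} (hn : Q n) :
    ∃ y k, node y k = n ∧ ∀ j, Q (node y j) := by
  obtain ⟨y, k, rfl⟩ := exists_node_eq n
  have hstep : ∀ m, Q m → ∃ a : Fin 2, Q (2 * m + a + 1) := fun m hm =>
    (hQ.child hm).elim (⟨0, ·⟩) (⟨1, ·⟩)
  choose! next hnext using hstep
  let f : ℕ → ℕ := fun j => Nat.rec (node y k) (fun _ m => 2 * m + next m + 1) j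
  let y' : Seq 2 := fun i => if i < k then y i else next (f (i - k))
  have hy' : node y' k = node y k := node_congr fun i hi => if_pos hi
  have hf (j : ℕ) : node y' (k + j) = f j := by
    induction j with
    | zero => exact hy'
    | succ j ih => simp [node, ih, y', f]
  have hQf (j : ℕ) : Q (f j) := by
    induction j with
    | zero => exact hn
    | succ j ih => exact hnext _ ih
  refine ⟨y', k, hy', fun j => ?_⟩
  rcases le_total j k with hj | hj
  · exact hQ.node_of_le (hy' ▸ hn) j hj
  · obtain ⟨i, rfl⟩ := Nat.exists_eq_add_of_le hj
    exact hf i ▸ hQf i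

end IsPrunedTree

end Nodes

section CodedTrees

/-- The number of nodes of the tree coded by `z` that precede the node `n`: the position in `z` of
the symbol that tells the children of `n`, if `n` is in the tree. -/
def rank (z : Seq 3) (n : ℕ) : ℕ := Nat.count (fun m => nodeInTree z m = true) n

theorem count_congr {p q : ℕ → Prop} [DecidablePred p] [DecidablePred q] {n : ℕ}
    (h : ∀ m < n, (p m ↔ q m)) : Nat.count p n = Nat.count q n :=
  List.countP_congr fun m hm => by simpa using h m (List.mem_range.1 hm)

@[simp] theorem nodeInTree_zero (z : Seq 3) : nodeInTree z 0 = true := by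
  rw [nodeInTree]

theorem nodeInTree_succ (z : Seq 3) (n : ℕ) :
    nodeInTree z (n + 1) = (nodeInTree z (n / 2) &&
      decide ((z (rank z (n / 2)) : ℕ) = n % 2 ∨ z (rank z (n / 2)) = 2)) := by
  have : (List.finRange (n / 2)).countP (fun m : Fin (n / 2) => nodeInTree z m)
      = rank z (n / 2) := by
    rw [rank, Nat.count, ← List.map_coe_finRange_eq_range, List.countP_map]
    congr 1
    ext
    simp
  rw [nodeInTree]
  simp only [this]

theorem rank_le (z : Seq 3) (n : ℕ) : rank z n ≤ n := Nat.count_le _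

theorem rank_succ (z : Seq 3) (n : ℕ) :
    rank z (n + 1) = rank z n + if nodeInTree z n then 1 else 0 := Nat.count_succ _ _

theorem rank_mono (z : Seq 3) : Monotone (rank z) := Nat.count_monotone _

theorem rank_congr {z z' : Seq 3} {n : ℕ} (h : ∀ m < n, nodeInTree z m = nodeInTree z' m) :
    rank z n = rank z' n :=
  count_congr fun m hm => by rw [h m hm]

theorem nodeInTree_left (z : Seq 3) (n : ℕ) :
    nodeInTree z (2 * n + 1) = (nodeInTree z n && decide (z (rank z n) ≠ 1)) := by
  rw [nodeInTree_succ, show 2 * n / 2 = n by omega, show 2 * n % 2 = 0 by omega]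
  congr 1
  generalize z (rank z n) = a
  revert a; decide

theorem nodeInTree_right (z : Seq 3) (n : ℕ) :
    nodeInTree z (2 * n + 2) = (nodeInTree z n && decide (z (rank z n) ≠ 0)) := by
  rw [nodeInTree_succ, show (2 * n + 1) / 2 = n by omega, show (2 * n + 1) % 2 = 1 by omega]
  congr 1
  generalize z (rank z n) = a
  revert a; decide

theorem nodeInTree_congr {z z' : Seq 3} {n k : ℕ}
    (hk : ∀ m, 2 * m < n → nodeInTree z m = true → rank z m < k) (h : ∀ i < k, z i = z' i) :
    ∀ m ≤ n, nodeInTree z m = nodeInTree z' m := by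
  intro m
  induction m using Nat.strong_induction_on with
  | _ m ih =>
    intro hm
    rcases m with _ | m
    · simp
    have hrank : rank z (m / 2) = rank z' (m / 2) :=
      rank_congr fun j hj => ih j (by omega) (by omega)
    rw [nodeInTree_succ, nodeInTree_succ, ← hrank, ← ih (m / 2) (by omega) (by omega)]
    rcases hnode : nodeInTree z (m / 2) with _ | _
    · rfl
    · rw [h _ (hk (m / 2) (by omega) hnode)]

theorem nodeInTree_congr_of_lt {z z' : Seq 3} {n : ℕ} (h : ∀ i < n, z i = z' i) :
    ∀ m ≤ n, nodeInTree z m = nodeInTree z' m :=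
  nodeInTree_congr (fun m hm _ => (rank_le z m).trans_lt (by omega)) h

theorem mem_paths_codedTree {z : Seq 3} {y : Seq 2} :
    y ∈ paths (codedTree z) ↔ ∀ k, nodeInTree z (node y k) = true := by
  simp [paths, codedTree, strIndex_prefixOf]

theorem isPrunedTree_nodeInTree (z : Seq 3) : IsPrunedTree (nodeInTree z · = true) where
  root := nodeInTree_zero z
  parent h := by
    rw [nodeInTree_succ, Bool.and_eq_true] at h
    exact h.1
  child {n} h := by
    rw [nodeInTree_left, nodeInTree_right, h]
    generalize z (rank z n) = a
    revert a; decide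

theorem infinite_nodeInTree (z : Seq 3) : {n | nodeInTree z n = true}.Infinite := by
  obtain ⟨y, -, -, hy⟩ := (isPrunedTree_nodeInTree z).exists_branch (nodeInTree_zero z)
  exact Set.infinite_of_forall_exists_gt fun a =>
    ⟨node y (a + 1), hy _, (Nat.lt_succ_self a).trans_le (le_node y _)⟩

theorem nodeInTree_injective : Function.Injective nodeInTree := by
  intro z z' h
  have h (n : ℕ) : nodeInTree z n = nodeInTree z' n := congrFun h n
  funext i
  have hn := Nat.nth_mem_of_infinite (infinite_nodeInTree z) i
  have hi := Nat.count_nth_of_infinite (infinite_nodeInTree z) i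
  generalize Nat.nth _ i = n at hn hi
  replace hi : rank z n = i := hi
  have h1 := h (2 * n + 1)
  have h2 := h (2 * n + 2)
  rw [nodeInTree_left, nodeInTree_left, ← h n, hn, ← rank_congr fun m _ => h m, hi] at h1
  rw [nodeInTree_right, nodeInTree_right, ← h n, hn, ← rank_congr fun m _ => h m, hi] at h2
  revert h1 h2
  generalize z i = a
  generalize z' i = b
  revert a b; decide

theorem IsPrunedTree.exists_code {Q : ℕ → Prop} (hQ : IsPrunedTree Q) :
    ∃ z : Seq 3, ∀ n, nodeInTree z n = true ↔ Q n := by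
  classical
  let z : Seq 3 := fun i => if ¬ Q (2 * Nat.nth Q i + 1) then 1 else
    if ¬ Q (2 * Nat.nth Q i + 2) then 0 else 2
  refine ⟨z, fun n => ?_⟩
  induction n using Nat.strong_induction_on with
  | _ n ih =>
    rcases n with _ | n
    · simp [hQ.root]
    have hrank : rank z (n / 2) = Nat.count Q (n / 2) := count_congr fun m hm => ih m (by omega)
    rw [nodeInTree_succ, hrank, Bool.and_eq_true, ih (n / 2) (by omega), decide_eq_true_eq]
    by_cases hn : Q (n / 2)
    · have hchild := hQ.child hn
      simp only [z, Nat.nth_count hn]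
      rcases Nat.mod_two_eq_zero_or_one n with h | h
      · rw [show n + 1 = 2 * (n / 2) + 1 by omega]
        grind
      · rw [show n + 1 = 2 * (n / 2) + 2 by omega]
        grind
    · exact iff_of_false (fun h => hn h.1) (fun h => hn (hQ.parent h))

theorem exists_paths_codedTree_eq {C : Set (Seq 2)} (hC : IsClosed C) (hne : C.Nonempty) :
    ∃ z, paths (codedTree z) = C := by
  have hQ : IsPrunedTree fun n => ∃ y ∈ C, ∃ k, node y k = n :=
    { root := hne.imp fun y hy => ⟨hy, 0, rfl⟩
      parent := by
        rintro n ⟨y, hy, _ | k, hk⟩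
        · simp [node] at hk
        · simp only [node, Nat.add_right_cancel_iff] at hk
          exact ⟨y, hy, k, by omega⟩
      child := by
        rintro _ ⟨y, hy, k, rfl⟩
        have : node y (k + 1) = 2 * node y k + 1 ∨ node y (k + 1) = 2 * node y k + 2 := by
          simp only [node]; omega
        exact this.imp (fun h => ⟨y, hy, _, h⟩) fun h => ⟨y, hy, _, h⟩ }
  obtain ⟨z, hz⟩ := hQ.exists_code
  refine ⟨z, Set.Subset.antisymm (fun y hy => ?_) fun y hy => ?_⟩
  · have happrox (k : ℕ) : ∃ y' ∈ C, ∀ i < k, y' i = y i := by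
      obtain ⟨y', hy', k', hk'⟩ := (hz _).1 (mem_paths_codedTree.1 hy k)
      obtain ⟨rfl, h⟩ := node_eq_node_iff.1 hk'
      exact ⟨y', hy', h⟩
    choose y' hy'C hy' using happrox
    have htendsto : Filter.Tendsto y' Filter.atTop (nhds y) := tendsto_pi_nhds.2 fun i =>
      tendsto_nhds_of_eventually_eq
        (Filter.eventually_atTop.2 ⟨i + 1, fun k hk => hy' k i (by omega)⟩)
    exact hC.mem_of_tendsto htendsto (.of_forall hy'C)
  · exact mem_paths_codedTree.2 fun k => (hz _).2 ⟨y, hy, k, rfl⟩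

theorem paths_codedTree_injective : Function.Injective fun z => paths (codedTree z) := by
  suffices h : ∀ z z', paths (codedTree z) = paths (codedTree z') →
      ∀ n, nodeInTree z n = true → nodeInTree z' n = true from fun z z' hzz' =>
    nodeInTree_injective (funext fun n => Bool.eq_iff_iff.2 ⟨h z z' hzz' n, h z' z hzz'.symm n⟩)
  intro z z' h n hn
  obtain ⟨y, k, rfl, hy⟩ := (isPrunedTree_nodeInTree z).exists_branch hn
  exact mem_paths_codedTree.1 (h ▸ mem_paths_codedTree.2 hy) k

end CodedTrees

section Labelings

open Filter

/-- The sequence of labels that `x` gives to the nodes on the branch `y`, without the root. -/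
def branchLabels {n : ℕ} (x : Seq n) (y : Seq 2) : Seq n := fun k => x (2 * node y k + y k)

/-- The branches that avoid the label `1`. -/
def survivors (x : Seq 3) : Set (Seq 2) := {y | ∀ k, branchLabels x y k ≠ 1}

/-- Almost all labels of some branch are in `S`. -/
def HasTailIn {n : ℕ} (S : Finset (Fin n)) (x : Seq n) : Prop :=
  ∃ y, ∀ᶠ k in atTop, branchLabels x y k ∈ S

theorem label_prefixOf (x : Seq 3) (y : Seq 2) (k : ℕ) :
    label x (prefixOf y (k + 1)) = branchLabels x y k := by
  rw [label, strIndex_prefixOf, node, Nat.add_sub_cancel, branchLabels]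

theorem codedFun_apply (x : Seq 3) (y : Seq 2) : codedFun x y = removeTwos (branchLabels x y) := by
  simp only [codedFun, label_prefixOf]

theorem isClosed_survivors (x : Seq 3) : IsClosed (survivors x) := by
  have : survivors x = ⋂ k, {y | label x (prefixOf y (k + 1)) ≠ 1} := by
    ext y
    simp [survivors, label_prefixOf]
  exact this ▸ isClosed_iInter fun k => (isClopen_setOf_prefixOf (k + 1) (label x · ≠ 1)).isClosed

theorem zero_mem_removeTwos_iff {a : Seq 3} :
    (fun _ => 0) ∈ removeTwos a ↔ {k | a k ≠ 2}.Infinite ∧ ∀ k, a k ≠ 1 := by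
  refine ⟨fun ⟨h, hzero⟩ => ⟨h, fun k hk => ?_⟩, fun ⟨h, hone⟩ => ⟨h, funext fun j => Fin.ext ?_⟩⟩
  · have hval := congrArg Fin.val (congrFun hzero (Nat.count (fun k => a k ≠ 2) k))
    simp only [removeTwos, Fin.val_castLT] at hval
    rw [Nat.nth_count (p := fun k => a k ≠ 2) (by simp [hk]), hk] at hval
    exact absurd hval one_ne_zero
  · have hzero : ∀ b : Fin 3, b ≠ 2 → b ≠ 1 → (b : ℕ) = 0 := by decide
    exact hzero _ (Nat.nth_mem_of_infinite h j) (hone _)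

theorem zeroSet_codedFun {x : Seq 3} (hx : ¬ HasTailIn {2} x) :
    zeroSet (codedFun x) = survivors x := by
  ext y
  have hinf : {k | branchLabels x y k ≠ 2}.Infinite := by
    refine Nat.frequently_atTop_iff_infinite.1 fun h => hx ⟨y, h.mono fun k hk => ?_⟩
    simpa using hk
  exact (codedFun_apply x y ▸ zero_mem_removeTwos_iff).trans (and_iff_right hinf)

theorem nth_congr {p q : ℕ → Prop} (hp : {k | p k}.Infinite) {j : ℕ}
    (h : ∀ i ≤ Nat.nth p j, (p i ↔ q i)) : Nat.nth q j = Nat.nth p j := by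
  classical
  have hcount : Nat.count q (Nat.nth p j) = j := by
    rw [← count_congr fun i hi => h i hi.le, Nat.count_nth_of_infinite hp]
  conv_lhs => rw [← hcount]
  exact Nat.nth_count ((h _ le_rfl).1 (Nat.nth_mem_of_infinite hp j))

theorem removeTwos_get_congr {a a' : Seq 3} (ha : (removeTwos a).Dom) (ha' : (removeTwos a').Dom)
    {j : ℕ} (h : ∀ i ≤ Nat.nth (a · ≠ 2) j, a i = a' i) :
    (removeTwos a').get ha' j = (removeTwos a).get ha j := by
  have hnth : Nat.nth (a' · ≠ 2) j = Nat.nth (a · ≠ 2) j :=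
    nth_congr ha fun i hi => by rw [h i hi]
  simp only [removeTwos]
  congr 1
  rw [hnth, h _ le_rfl]

theorem isContinuousPartial_codedFun (x : Seq 3) : IsContinuousPartial (codedFun x) := by
  refine continuous_pi fun j => continuous_iff_continuousAt.2 fun ⟨y, hy⟩ => ?_
  have hdom {y' : Seq 2} (hy' : y' ∈ (codedFun x).Dom) :
      (removeTwos (branchLabels x y')).Dom := codedFun_apply x y' ▸ hy'
  have hfn (y' : Seq 2) (hy' : y' ∈ (codedFun x).Dom) :
      (codedFun x).fn y' hy' = (removeTwos (branchLabels x y')).get (hdom hy') := by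
    simp only [PFun.fn, codedFun_apply]
  set N := Nat.nth (branchLabels x y · ≠ 2) j
  have hopen : IsOpen {y' : Seq 2 | prefixOf y' (N + 1) = prefixOf y (N + 1)} :=
    (isClopen_setOf_prefixOf (N + 1) (· = prefixOf y (N + 1))).isOpen
  have hnear : ∀ᶠ y' : (codedFun x).Dom in nhds ⟨y, hy⟩,
      prefixOf y'.1 (N + 1) = prefixOf y (N + 1) :=
    (hopen.preimage continuous_subtype_val).mem_nhds rfl
  refine tendsto_nhds_of_eventually_eq (hnear.mono fun ⟨y', hy'⟩ h => ?_)
  have h := prefixOf_eq_iff.1 h.symm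
  simp only [hfn]
  refine removeTwos_get_congr _ _ fun i hi => ?_
  rw [branchLabels, branchLabels, node_congr fun i' hi' => h i' (by omega), h i (by omega)]

/-- Whether a label `1` occurs on the way from the root to the node `n`. -/
def killed (x : Seq 3) : ℕ → Bool
  | 0 => false
  | n + 1 => killed x (n / 2) || decide (x n = 1)
  decreasing_by omega

theorem killed_node_succ (x : Seq 3) (y : Seq 2) (k : ℕ) :
    killed x (node y (k + 1)) = (killed x (node y k) || decide (branchLabels x y k = 1)) := by
  rw [node, killed, two_mul_node_add_div_two, branchLabels]

theorem killed_node_of_mem_survivors {x : Seq 3} {y : Seq 2} (hy : y ∈ survivors x) (k : ℕ) :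
    killed x (node y k) = false := by
  induction k with
  | zero => rw [node, killed]
  | succ k ih => simp [killed_node_succ, ih, hy k]

theorem killed_congr {x x' : Seq 3} {n : ℕ} (h : ∀ i < n, x i = x' i) :
    killed x n = killed x' n := by
  induction n using Nat.strong_induction_on with
  | _ n ih =>
    rcases n with _ | n
    · rw [killed, killed]
    · rw [killed, killed, ih (n / 2) (by omega) fun i hi => h i (by omega), h n n.lt_succ_self]

end Labelings

section Coupling

/-- The label of a node, computed from a uniform symbol `a`, if `t` tells whether some surviving
branch has to pass through the node and `d` whether a label `1` occurs above it. In a uniform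
labeling, some branch below a node avoids the label `1` with probability
`p = 1 - (1 - 2 * p / 3) ^ 2`, hence `p = 3 / 4`. If the label of a node and what is below it leave
no surviving branch, which happens with probability `1 / 2`, then the label is `1` with conditional
probability `2 / 3`. -/
def emit (t d : Bool) (a : Fin 6) : Fin 3 :=
  if t then (if a.val % 2 = 0 then 0 else 2)
  else if d then ⟨a.val % 3, by omega⟩
  else if a.val < 4 then 1 else if a.val = 4 then 0 else 2

/-- Whether the node `n` is on a branch that has to survive in `couple p`: a branch of the tree
coded by the second component of `p`, provided that the first component is true. -/
def marked (p : Bool × Seq 3 × Seq 6) (n : ℕ) : Bool := p.1 && nodeInTree p.2.1 n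

/-- Whether a label `1` occurs on the way from the root to the node `n` in the labeling `couple p`;
see `killed_couple`. -/
def cut (p : Bool × Seq 3 × Seq 6) : ℕ → Bool
  | 0 => false
  | n + 1 => cut p (n / 2) || decide (emit (marked p (n + 1)) (cut p (n / 2)) (p.2.2 n) = 1)
  decreasing_by all_goals omega

/-- A labeling with prescribed survivors: outside a null set of `r`, the survivors of
`couple (c, z, r)` are the branches of the tree coded by `z` if `c` is true, and there are none if
`c` is false. -/
def couple (p : Bool × Seq 3 × Seq 6) : Seq 3 := fun n =>
  emit (marked p (n + 1)) (cut p (n / 2)) (p.2.2 n)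

theorem killed_couple (p : Bool × Seq 3 × Seq 6) (n : ℕ) : killed (couple p) n = cut p n := by
  induction n using Nat.strong_induction_on with
  | _ n ih =>
    rcases n with _ | n
    · rw [killed, cut]
    · rw [killed, cut, ih (n / 2) (by omega), couple]

theorem couple_apply (p : Bool × Seq 3 × Seq 6) (n : ℕ) :
    couple p n = emit (marked p (n + 1)) (killed (couple p) (n / 2)) (p.2.2 n) := by
  rw [killed_couple, couple]

theorem couple_congr {p q : Bool × Seq 3 × Seq 6} {n : ℕ}
    (hmarked : ∀ m ≤ n, marked p m = marked q m) (hr : ∀ m < n, p.2.2 m = q.2.2 m) :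
    ∀ m < n, couple p m = couple q m := by
  intro m
  induction m using Nat.strong_induction_on with
  | _ m ih =>
    intro hm
    rw [couple_apply, couple_apply, hmarked (m + 1) hm, hr m hm,
      killed_congr (n := m / 2) fun i hi => ih i (by omega) (by omega)]

theorem branchLabels_couple (p : Bool × Seq 3 × Seq 6) (y : Seq 2) (k : ℕ) :
    branchLabels (couple p) y k = emit (marked p (node y (k + 1)))
      (killed (couple p) (node y k)) (branchLabels p.2.2 y k) := by
  rw [branchLabels, couple_apply, two_mul_node_add_div_two, node, branchLabels]

theorem emit_true_ne_one : ∀ (d : Bool) (a : Fin 6), emit true d a ≠ 1 := by decide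

theorem mem_of_emit_ne_one : ∀ a : Fin 6, emit false false a ≠ 1 → a ∈ ({4, 5} : Finset _) := by
  decide

theorem paths_subset_survivors_couple (z : Seq 3) (r : Seq 6) :
    paths (codedTree z) ⊆ survivors (couple (true, z, r)) := by
  intro y hy k
  rw [branchLabels_couple, marked, mem_paths_codedTree.1 hy (k + 1)]
  exact emit_true_ne_one _ _

theorem marked_node_of_mem_survivors_couple {p : Bool × Seq 3 × Seq 6}
    (hr : ¬ HasTailIn {4, 5} p.2.2) {y : Seq 2} (hy : y ∈ survivors (couple p)) (k : ℕ) :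
    marked p (node y k) = true := by
  by_contra hk
  refine hr ⟨y, Filter.eventually_atTop.2 ⟨k, fun j hj => mem_of_emit_ne_one _ ?_⟩⟩
  have hout : marked p (node y (j + 1)) = false := Bool.eq_false_iff.2 fun h => hk <| by
    rw [marked, Bool.and_eq_true] at h ⊢
    exact ⟨h.1, (isPrunedTree_nodeInTree _).node_of_le h.2 k (by omega)⟩
  have hlabel := hy j
  rwa [branchLabels_couple, hout, killed_node_of_mem_survivors hy] at hlabel

theorem eq_true_of_nonempty_survivors_couple {p : Bool × Seq 3 × Seq 6}
    (hr : ¬ HasTailIn {4, 5} p.2.2) (h : (survivors (couple p)).Nonempty) : p.1 = true := by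
  obtain ⟨y, hy⟩ := h
  exact (Bool.and_eq_true_iff.1 (marked_node_of_mem_survivors_couple hr hy 0)).1

theorem survivors_couple_true {z : Seq 3} {r : Seq 6} (hr : ¬ HasTailIn {4, 5} r) :
    survivors (couple (true, z, r)) = paths (codedTree z) :=
  Set.Subset.antisymm
    (fun _ hy => mem_paths_codedTree.2 (marked_node_of_mem_survivors_couple hr hy))
    (paths_subset_survivors_couple z r)

end Coupling

section Strings

/-- All strings of length `N` over an alphabet with `n` symbols. -/
def strings (n : ℕ) : ℕ → List (List (Fin n))
  | 0 => [[]]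
  | N + 1 => (strings n N).flatMap fun σ => (List.finRange n).map fun a => a :: σ

variable {n : ℕ}

theorem mem_strings {N : ℕ} {σ : List (Fin n)} : σ ∈ strings n N ↔ σ.length = N := by
  induction N generalizing σ with
  | zero => simp [strings]
  | succ N ih => cases σ <;> simp [strings, ih]

theorem prefixOf_mem_strings (x : Seq n) (N : ℕ) : prefixOf x N ∈ strings n N :=
  mem_strings.2 (length_prefixOf x N)

theorem nodup_strings (n N : ℕ) : (strings n N).Nodup := by
  induction N with
  | zero => simp [strings]
  | succ N ih =>
    refine List.nodup_flatMap.2 ⟨fun σ _ => (List.nodup_finRange n).map fun a b h => ?_,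
      ih.imp fun {σ τ} hστ => List.disjoint_left.2 ?_⟩
    · exact (List.cons.inj h).1
    simp only [List.mem_map, not_exists, not_and]
    rintro _ ⟨a, -, rfl⟩ b - h
    exact hστ (List.cons.inj h).2.symm

/-- The sequence that extends a string by zeros. -/
def ofList [NeZero n] (σ : List (Fin n)) : Seq n := fun i => σ.getD i 0

theorem ofList_prefixOf [NeZero n] (x : Seq n) {N i : ℕ} (h : i < N) :
    ofList (prefixOf x N) i = x i := getD_prefixOf x 0 h

theorem prefixOf_ofList [NeZero n] (σ : List (Fin n)) : prefixOf (ofList σ) σ.length = σ :=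
  List.ext_getElem (by simp) fun i _ _ => by simp [prefixOf, ofList]

end Strings

section Lebesgue

variable {n : ℕ}

theorem measure_setOf_prefixOf (ν : Measure (Seq n)) (N : ℕ) (P : List (Fin n) → Prop)
    [DecidablePred P] : ν {x | P (prefixOf x N)} =
      ∑ σ ∈ (strings n N).toFinset with P σ, ν {x | prefixOf x N = σ} := by
  have hmeas (σ : List (Fin n)) : MeasurableSet {x : Seq n | prefixOf x N = σ} :=
    (isClopen_setOf_prefixOf N (· = σ)).isOpen.measurableSet
  refine Eq.trans (congrArg ν ?_) (sum_measure_preimage_singleton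
    (f := fun x : Seq n => prefixOf x N) _ fun σ _ => hmeas σ).symm
  ext x
  simp [prefixOf_mem_strings]

variable [NeZero n]

instance : IsProbabilityMeasure (lebesgue n) := by
  unfold lebesgue
  infer_instance

theorem lebesgue_setOf_forall_mem (s : Finset ℕ) (F : ℕ → Finset (Fin n)) :
    lebesgue n {x | ∀ i ∈ s, x i ∈ F i} = ∏ i ∈ s, (F i).card / (n : ℝ≥0∞) := by
  have : {x : Seq n | ∀ i ∈ s, x i ∈ F i} = Set.pi s fun i => F i := by
    ext x
    simp [Set.mem_pi]
  rw [this, lebesgue, Measure.infinitePi_pi _ fun i _ => (F i).measurableSet]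
  exact Finset.prod_congr rfl fun i _ => by
    simp [PMF.toMeasure_uniformOfFintype_apply _ (F i).measurableSet]

theorem lebesgue_setOf_prefixOf_eq (x : Seq n) (N : ℕ) :
    lebesgue n {y | prefixOf y N = prefixOf x N} = (n : ℝ≥0∞)⁻¹ ^ N := by
  have := lebesgue_setOf_forall_mem (Finset.range N) fun i => {x i}
  simpa [prefixOf_eq_iff] using this

open Classical in
theorem lebesgue_setOf_prefixOf (N : ℕ) (P : List (Fin n) → Prop) :
    lebesgue n {x | P (prefixOf x N)} =
      ((strings n N).filter fun σ => P σ).length * (n : ℝ≥0∞)⁻¹ ^ N := by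
  have hcylinder : ∀ σ ∈ (strings n N).toFinset.filter P,
      lebesgue n {x | prefixOf x N = σ} = (n : ℝ≥0∞)⁻¹ ^ N := by
    intro σ hσ
    obtain rfl : σ.length = N := mem_strings.1 (List.mem_toFinset.1 (Finset.mem_filter.1 hσ).1)
    conv_lhs => rw [← prefixOf_ofList σ]
    simpa using lebesgue_setOf_prefixOf_eq (ofList σ) σ.length
  rw [measure_setOf_prefixOf, Finset.sum_congr rfl hcylinder, Finset.sum_const, nsmul_eq_mul,
    ← List.toFinset_card_of_nodup ((nodup_strings n N).filter _), List.toFinset_filter]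
  simp

theorem eq_lebesgue {ν : Measure (Seq n)}
    (h : ∀ N, ∃ M ≥ N, ∀ x, ν {y | prefixOf y M = prefixOf x M} = (n : ℝ≥0∞)⁻¹ ^ M) :
    ν = lebesgue n := by
  classical
  refine Measure.eq_infinitePi _ fun s t ht => ?_
  rw [← Measure.infinitePi_pi _ fun i _ => ht i, ← lebesgue]
  obtain ⟨M, hM, hν⟩ := h (s.sup id + 1)
  have hbox : Set.pi (s : Set ℕ) t = {x | ofList (prefixOf x M) ∈ Set.pi (s : Set ℕ) t} := by
    ext x
    refine forall₂_congr fun i hi => ?_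
    have : i ≤ s.sup id := Finset.le_sup (f := id) hi
    rw [ofList_prefixOf x (by omega)]
  rw [hbox, measure_setOf_prefixOf ν M (ofList · ∈ Set.pi (s : Set ℕ) t),
    measure_setOf_prefixOf _ M (ofList · ∈ Set.pi (s : Set ℕ) t)]
  refine Finset.sum_congr rfl fun σ hσ => ?_
  obtain rfl : σ.length = M := mem_strings.1 (List.mem_toFinset.1 (Finset.mem_filter.1 hσ).1)
  rw [← prefixOf_ofList σ, length_prefixOf, hν, lebesgue_setOf_prefixOf_eq]

theorem measurePreserving_rotate (k : ℕ) (a : Fin n) :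
    MeasurePreserving (fun x : Seq n => Function.update x k (x k + a)) (lebesgue n)
      (lebesgue n) := by
  have hcoord : (fun x : Seq n => Function.update x k (x k + a)) =
      fun x i => (if i = k then (· + a) else id : Fin n → Fin n) (x i) := by
    ext x i
    rcases eq_or_ne i k with rfl | h <;> simp [*]
  have hshift : (PMF.uniformOfFintype (Fin n)).toMeasure.map (· + a) =
      (PMF.uniformOfFintype (Fin n)).toMeasure := by
    refine Measure.ext_of_singleton fun b => ?_
    rw [Measure.map_apply .of_discrete (measurableSet_singleton b),
      show (· + a) ⁻¹' {b} = {b - a} by ext; exact eq_sub_iff_add_eq.symm,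
      PMF.toMeasure_apply_singleton _ _ (measurableSet_singleton _),
      PMF.toMeasure_apply_singleton _ _ (measurableSet_singleton _)]
    simp
  rw [hcoord]
  refine ⟨by fun_prop, ?_⟩
  rw [lebesgue, Measure.infinitePi_map_pi _ fun i => .of_discrete]
  congr with i : 1
  split_ifs
  · exact hshift
  · exact Measure.map_id

end Lebesgue

section Invariance

variable {Ω : Type*} [MeasurableSpace Ω] {μ : Measure Ω}

theorem measurePreserving_choice {ι : Type*} [Countable ι] [MeasurableSpace ι]
    [MeasurableSingletonClass ι] {f : ι → Ω → Ω} {s : Ω → ι}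
    (hf : ∀ i, MeasurePreserving (f i) μ μ) (hs : Measurable s)
    (hsf : ∀ i ω, s (f i ω) = i ↔ s ω = i) : MeasurePreserving (fun ω => f (s ω) ω) μ μ := by
  have hmeas (i : ι) : MeasurableSet (s ⁻¹' {i}) := hs (measurableSet_singleton i)
  have hcover : ⋃ i, s ⁻¹' {i} = Set.univ := Set.iUnion_eq_univ_iff.2 fun ω => ⟨s ω, rfl⟩
  have hpre (i : ι) (A : Set Ω) :
      (fun ω => f (s ω) ω) ⁻¹' A ∩ s ⁻¹' {i} = f i ⁻¹' (A ∩ s ⁻¹' {i}) := by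
    ext ω
    simp only [Set.mem_inter_iff, Set.mem_preimage, Set.mem_singleton_iff, hsf]
    exact and_congr_left fun h => by rw [h]
  have hmeasurable : Measurable fun ω => f (s ω) ω := by
    intro A hA
    rw [← Set.inter_univ (_ ⁻¹' A), ← hcover, Set.inter_iUnion]
    exact .iUnion fun i => hpre i A ▸ (hf i).measurable (hA.inter (hmeas i))
  refine ⟨hmeasurable, Measure.ext fun A hA => ?_⟩
  have hdisj : Pairwise (Function.onFun Disjoint fun i => s ⁻¹' {i}) :=
    pairwise_disjoint_fiber s
  have hsum (B : Set Ω) (hB : MeasurableSet B) : μ B = ∑' i, μ (B ∩ s ⁻¹' {i}) := by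
    rw [← measure_iUnion (fun i j hij => (hdisj hij).mono Set.inter_subset_right
      Set.inter_subset_right) fun i => hB.inter (hmeas i), ← Set.inter_iUnion,
      hcover, Set.inter_univ]
  rw [Measure.map_apply hmeasurable hA, hsum _ (hmeasurable hA), hsum A hA]
  exact tsum_congr fun i => by
    rw [hpre, (hf i).measure_preimage (hA.inter (hmeas i)).nullMeasurableSet]

theorem measureReal_inter_preimage_finset [IsFiniteMeasure μ] {G : Type*} [AddGroup G] [Fintype G]
    [MeasurableSpace G] [MeasurableSingletonClass G] {u : Ω → G} (hu : Measurable u)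
    {A : Set Ω} (hA : MeasurableSet A) {R : G → Ω → Ω}
    (hR : ∀ g, MeasurePreserving (R g) μ μ) (hRu : ∀ g ω, u (R g ω) = u ω + g)
    (hRA : ∀ g, R g ⁻¹' A = A) (S : Finset G) :
    μ.real (A ∩ u ⁻¹' S) = S.card / Fintype.card G * μ.real A := by
  have hfiber (g : G) : MeasurableSet (A ∩ u ⁻¹' {g}) := hA.inter (hu (measurableSet_singleton g))
  have hequal (g : G) : μ.real (A ∩ u ⁻¹' {g}) = μ.real (A ∩ u ⁻¹' {0}) := by
    rw [← (hR g).measureReal_preimage (hfiber g).nullMeasurableSet, Set.preimage_inter, hRA]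
    congr 2
    ext ω
    simp [hRu]
  have hcard (S : Finset G) : μ.real (A ∩ u ⁻¹' S) = S.card * μ.real (A ∩ u ⁻¹' {0}) := by
    have hunion : A ∩ u ⁻¹' S = ⋃ g ∈ S, A ∩ u ⁻¹' {g} := by
      ext
      simp
    rw [hunion, measureReal_biUnion_finset (fun g _ g' _ h =>
      ((Set.disjoint_singleton.2 h).preimage u).mono Set.inter_subset_right Set.inter_subset_right)
      fun g _ => hfiber g, Finset.sum_congr rfl fun g _ => hequal g, Finset.sum_const, nsmul_eq_mul]
  have htotal := hcard Finset.univ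
  rw [Finset.coe_univ, Set.preimage_univ, Set.inter_univ, Finset.card_univ] at htotal
  rw [htotal, hcard]
  field_simp

end Invariance

section FinitePrefixes

variable {γ : Type*} {m l : ℕ}

/-- The finite information about a triple that consists of its first component and of the prefixes
of length `N` of the two sequences. -/
def prefixes (p : γ × Seq m × Seq l) (N : ℕ) : γ × List (Fin m) × List (Fin l) :=
  (p.1, prefixOf p.2.1 N, prefixOf p.2.2 N)

theorem prefixes_eq_iff {p q : γ × Seq m × Seq l} {N : ℕ} : prefixes p N = prefixes q N ↔
    p.1 = q.1 ∧ (∀ i < N, p.2.1 i = q.2.1 i) ∧ ∀ i < N, p.2.2 i = q.2.2 i := by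
  rw [prefixes, prefixes, Prod.mk_inj, Prod.mk_inj, prefixOf_eq_iff, prefixOf_eq_iff]

theorem isClopen_of_prefixes [TopologicalSpace γ] [DiscreteTopology γ]
    {A : Set (γ × Seq m × Seq l)} (N : ℕ)
    (hA : ∀ p q, prefixes p N = prefixes q N → p ∈ A → q ∈ A) : IsClopen A := by
  let f : γ × Seq m × Seq l → γ × (Fin N → Fin m) × (Fin N → Fin l) := fun p =>
    (p.1, fun i => p.2.1 i, fun i => p.2.2 i)
  have hf : Continuous f := by fun_prop
  have hfA : f ⁻¹' (f '' A) = A := by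
    refine Set.Subset.antisymm (fun q ⟨p, hp, hpq⟩ => hA p q ?_ hp) (Set.subset_preimage_image f A)
    simp only [f, Prod.mk.injEq, funext_iff, Fin.forall_iff] at hpq
    exact prefixes_eq_iff.2 hpq
  exact hfA ▸ (isClopen_discrete _).preimage hf

theorem measurableSet_of_prefixes [TopologicalSpace γ] [DiscreteTopology γ] [MeasurableSpace γ]
    [OpensMeasurableSpace γ] {A : Set (γ × Seq m × Seq l)} (N : ℕ)
    (hA : ∀ p q, prefixes p N = prefixes q N → p ∈ A → q ∈ A) : MeasurableSet A :=
  (isClopen_of_prefixes N hA).isOpen.measurableSet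

end FinitePrefixes

section Law

open ProbabilityTheory

theorem nodeInTree_congr_of_lt_rank {z z' : Seq 3} {n : ℕ} (h : ∀ i < rank z n, z i = z' i) :
    ∀ m ≤ 2 * n, nodeInTree z m = nodeInTree z' m :=
  nodeInTree_congr (fun m hm hnode => by
    have hrank := rank_mono z (show m + 1 ≤ n by omega)
    rw [rank_succ, hnode] at hrank
    exact hrank) h

theorem rank_update (z : Seq 3) (n : ℕ) (a : Fin 3) :
    rank (Function.update z (rank z n) a) n = rank z n :=
  rank_congr fun m hm => (nodeInTree_congr_of_lt_rank (n := n) (fun i hi =>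
    (Function.update_of_ne hi.ne _ _).symm) m (by omega)).symm

theorem measurable_rank (n : ℕ) : Measurable fun z => rank z n := by
  refine measurable_to_countable' fun i => ?_
  have : (rank · n) ⁻¹' {i} = {z | rank (ofList (prefixOf z n)) n = i} := by
    ext z
    have hz : ∀ i < n, ofList (prefixOf z n) i = z i := fun i hi => ofList_prefixOf z hi
    rw [Set.mem_preimage, Set.mem_singleton_iff, Set.mem_ofPred_eq, rank_congr (z' := z)
      fun m hm => nodeInTree_congr_of_lt hz m hm.le]
  exact this ▸ (isClopen_setOf_prefixOf n fun σ => rank (ofList σ) n = i).isOpen.measurableSet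

/-- Adding `a` to the symbol of `z` that tells the children of the node `n`. -/
def rotateAtRank (n : ℕ) (a : Fin 3) (z : Seq 3) : Seq 3 :=
  Function.update z (rank z n) (z (rank z n) + a)

theorem measurePreserving_rotateAtRank (n : ℕ) (a : Fin 3) :
    MeasurePreserving (rotateAtRank n a) (lebesgue 3) (lebesgue 3) := by
  refine measurePreserving_choice (f := fun i z => Function.update z i (z i + a))
    (fun i => measurePreserving_rotate i a) (measurable_rank n) fun i z => ⟨?_, ?_⟩
  · intro h
    have := rank_update (Function.update z i (z i + a)) n (z i)
    rw [h] at this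
    simpa using this
  · rintro rfl
    exact rank_update z n _

/-- The distribution of the triples to which `couple` is applied. -/
noncomputable def inputs : Measure (Bool × Seq 3 × Seq 6) :=
  (bernoulliMeasure true false ⟨3 / 4, by norm_num, by norm_num⟩).prod
    ((lebesgue 3).prod (lebesgue 6))

/-- The symbols on which the part of `couple p` and of `marked p` below the node `n` depends, as
opposed to what is above and to the left of it. -/
def nextSymbols (n : ℕ) (p : Bool × Seq 3 × Seq 6) : Fin 3 × Fin 6 × Fin 6 :=
  (p.2.1 (rank p.2.1 n), p.2.2 (2 * n), p.2.2 (2 * n + 1))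

/-- Adding `g` to `nextSymbols n`. -/
def rotateNext (n : ℕ) (g : Fin 3 × Fin 6 × Fin 6) (p : Bool × Seq 3 × Seq 6) :
    Bool × Seq 3 × Seq 6 :=
  (p.1, rotateAtRank n g.1 p.2.1, Function.update
    (Function.update p.2.2 (2 * n) (p.2.2 (2 * n) + g.2.1)) (2 * n + 1) (p.2.2 (2 * n + 1) + g.2.2))

instance : IsProbabilityMeasure inputs := by
  unfold inputs
  infer_instance

theorem measurePreserving_rotateNext (n : ℕ) (g : Fin 3 × Fin 6 × Fin 6) :
    MeasurePreserving (rotateNext n g) inputs inputs := by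
  have hr : MeasurePreserving (fun r : Seq 6 => Function.update
      (Function.update r (2 * n) (r (2 * n) + g.2.1)) (2 * n + 1) (r (2 * n + 1) + g.2.2))
      (lebesgue 6) (lebesgue 6) := by
    convert (measurePreserving_rotate (2 * n + 1) g.2.2).comp
      (measurePreserving_rotate (2 * n) g.2.1) using 2
    simp
  exact (MeasurePreserving.id _).prod ((measurePreserving_rotateAtRank n g.1).prod hr)

theorem nextSymbols_rotateNext (n : ℕ) (g : Fin 3 × Fin 6 × Fin 6) (p : Bool × Seq 3 × Seq 6) :
    nextSymbols n (rotateNext n g p) = nextSymbols n p + g := by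
  simp [nextSymbols, rotateNext, rotateAtRank, rank_update, Prod.ext_iff]

theorem marked_congr_of_prefixes {p q : Bool × Seq 3 × Seq 6} {N : ℕ}
    (h : prefixes p N = prefixes q N) : ∀ m ≤ N, marked p m = marked q m := by
  obtain ⟨h₁, h₂, -⟩ := prefixes_eq_iff.1 h
  intro m hm
  rw [marked, marked, h₁, nodeInTree_congr_of_lt h₂ m hm]

theorem prefixOf_couple_congr {p q : Bool × Seq 3 × Seq 6} {N : ℕ}
    (h : prefixes p N = prefixes q N) : prefixOf (couple p) N = prefixOf (couple q) N :=
  prefixOf_eq_iff.2 (couple_congr (marked_congr_of_prefixes h) (prefixes_eq_iff.1 h).2.2)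

theorem measurable_nextSymbols (n : ℕ) : Measurable (nextSymbols n) := by
  refine measurable_to_countable' fun g => measurableSet_of_prefixes (2 * n + 2) fun p q h hp => ?_
  obtain ⟨-, hz, hr⟩ := prefixes_eq_iff.1 h
  have hrank : rank p.2.1 n = rank q.2.1 n :=
    rank_congr fun m hm => nodeInTree_congr_of_lt hz m (by omega)
  have := rank_le q.2.1 n
  rwa [Set.mem_preimage, nextSymbols, hrank, hz _ (by omega), hr _ (by omega),
    hr _ (by omega)] at hp

theorem marked_left (p : Bool × Seq 3 × Seq 6) (n : ℕ) :
    marked p (2 * n + 1) = (marked p n && decide ((nextSymbols n p).1 ≠ 1)) := by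
  rw [marked, nodeInTree_left, ← Bool.and_assoc, marked, nextSymbols]

theorem marked_right (p : Bool × Seq 3 × Seq 6) (n : ℕ) :
    marked p (2 * n + 2) = (marked p n && decide ((nextSymbols n p).1 ≠ 0)) := by
  rw [marked, nodeInTree_right, ← Bool.and_assoc, marked, nextSymbols]

theorem marked_eq_or (p : Bool × Seq 3 × Seq 6) (n : ℕ) :
    marked p n = (marked p (2 * n + 1) || marked p (2 * n + 2)) := by
  rw [marked_left, marked_right, ← Bool.and_or_distrib_left]
  generalize (nextSymbols n p).1 = a
  revert a
  cases marked p n <;> decide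

/-- The event that `couple p` has the same first `2 * n` symbols as `x` and that `marked p` agrees
with `τ` on the frontier `n, …, 2 * n` of the part of the binary tree that these symbols label. -/
def frontierEvent (x : Seq 3) (τ : ℕ → Bool) (n : ℕ) : Set (Bool × Seq 3 × Seq 6) :=
  {p | prefixOf (couple p) (2 * n) = prefixOf x (2 * n) ∧
    ∀ m ∈ Finset.Ico n (2 * n + 1), marked p m = τ m}

theorem measurableSet_frontierEvent (x : Seq 3) (τ : ℕ → Bool) (n : ℕ) :
    MeasurableSet (frontierEvent x τ n) := by
  refine measurableSet_of_prefixes (2 * n) fun p q h hp => ⟨prefixOf_couple_congr h ▸ hp.1,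
    fun m hm => ?_⟩
  rw [← hp.2 m hm, marked_congr_of_prefixes h m (by grind)]

theorem preimage_rotateNext_frontierEvent (x : Seq 3) (τ : ℕ → Bool) (n : ℕ)
    (g : Fin 3 × Fin 6 × Fin 6) :
    rotateNext n g ⁻¹' frontierEvent x τ n = frontierEvent x τ n := by
  ext p
  have hmarked : ∀ m ≤ 2 * n, marked (rotateNext n g p) m = marked p m := fun m hm =>
    congrArg (p.1 && ·) (nodeInTree_congr_of_lt_rank (z := p.2.1)
      (z' := (rotateNext n g p).2.1) (fun i hi => (Function.update_of_ne hi.ne _ _).symm) m hm).symm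
  have hcouple : prefixOf (couple (rotateNext n g p)) (2 * n) = prefixOf (couple p) (2 * n) :=
    prefixOf_eq_iff.2 <| couple_congr hmarked fun m hm => by
      simp [rotateNext, Function.update_of_ne, show m ≠ 2 * n + 1 by omega,
        show m ≠ 2 * n by omega]
  refine and_congr (by rw [hcouple]) (forall₂_congr fun m hm => ?_)
  rw [hmarked m (by grind)]

/-- The values of `nextSymbols n` for which the children of the node `n` are marked as told by `t₁`
and `t₂` and labeled by `l₁` and `l₂`, if `d` tells whether a label `1` occurs on the way from the
root to `n`. -/
def goodSymbols (d t₁ t₂ : Bool) (l₁ l₂ : Fin 3) : Finset (Fin 3 × Fin 6 × Fin 6) :=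
  {g | ((t₁ || t₂) && decide (g.1 ≠ 1)) = t₁ ∧ ((t₁ || t₂) && decide (g.1 ≠ 0)) = t₂ ∧
    emit t₁ d g.2.1 = l₁ ∧ emit t₂ d g.2.2 = l₂}

/-- Four times the conditional probability that `marked p n = t`, given the labels outside the
subtree below `n`, if `d` tells whether a label `1` occurs on the way from the root to `n`. -/
def weight (d t : Bool) : ℕ :=
  if d then (if t then 0 else 4) else if t then 3 else 1

theorem card_goodSymbols_mul_weight : ∀ (d t₁ t₂ : Bool) (l₁ l₂ : Fin 3),
    (goodSymbols d t₁ t₂ l₁ l₂).card * weight d (t₁ || t₂) =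
      3 * weight (d || decide (l₁ = 1)) t₁ * weight (d || decide (l₂ = 1)) t₂ := by
  decide +kernel

theorem mem_frontierEvent_iff {x : Seq 3} {τ : ℕ → Bool} {n : ℕ} {p : Bool × Seq 3 × Seq 6} :
    p ∈ frontierEvent x τ n ↔ (∀ m < 2 * n, couple p m = x m) ∧
      (∀ m ∈ Finset.Ico (n + 1) (2 * n + 1), marked p m = τ m) ∧ marked p n = τ n := by
  rw [frontierEvent, Set.mem_ofPred_eq, prefixOf_eq_iff,
    ← Finset.insert_Ico_add_one_left_eq_Ico (show n < 2 * n + 1 by omega),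
    Finset.forall_mem_insert, and_comm (a := marked p n = τ n)]

theorem mem_frontierEvent_succ_iff {x : Seq 3} {τ : ℕ → Bool} {n : ℕ}
    {p : Bool × Seq 3 × Seq 6} : p ∈ frontierEvent x τ (n + 1) ↔
      (∀ m < 2 * n, couple p m = x m) ∧ (∀ m ∈ Finset.Ico (n + 1) (2 * n + 1), marked p m = τ m) ∧
      couple p (2 * n) = x (2 * n) ∧ couple p (2 * n + 1) = x (2 * n + 1) ∧
      marked p (2 * n + 1) = τ (2 * n + 1) ∧ marked p (2 * n + 2) = τ (2 * n + 2) := by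
  simp only [frontierEvent, Set.mem_ofPred_eq, prefixOf_eq_iff, Finset.mem_Ico]
  grind

theorem frontierEvent_succ (x : Seq 3) (τ : ℕ → Bool) (n : ℕ) : frontierEvent x τ (n + 1) =
    frontierEvent x (Function.update τ n (τ (2 * n + 1) || τ (2 * n + 2))) n ∩ nextSymbols n ⁻¹'
      goodSymbols (killed x n) (τ (2 * n + 1)) (τ (2 * n + 2)) (x (2 * n)) (x (2 * n + 1)) := by
  ext p
  have hτ : (∀ m ∈ Finset.Ico (n + 1) (2 * n + 1),
      marked p m = Function.update τ n (τ (2 * n + 1) || τ (2 * n + 2)) m) ↔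
      ∀ m ∈ Finset.Ico (n + 1) (2 * n + 1), marked p m = τ m :=
    forall₂_congr fun m hm => by rw [Function.update_of_ne (by grind)]
  rw [mem_frontierEvent_succ_iff, Set.mem_inter_iff, mem_frontierEvent_iff, hτ,
    Function.update_self, and_assoc, and_assoc]
  refine and_congr_right fun hx => and_congr_right fun _ => ?_
  have hkilled : killed (couple p) n = killed x n := killed_congr fun i hi => hx i (by omega)
  have hor := marked_eq_or p n
  rw [Set.mem_preimage, goodSymbols, Finset.mem_coe, Finset.mem_filter_univ, couple_apply p (2 * n),
    couple_apply p (2 * n + 1), show 2 * n / 2 = n by omega, show (2 * n + 1) / 2 = n by omega,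
    hkilled]
  constructor
  · rintro ⟨hx₁, hx₂, hτ₁, hτ₂⟩
    rw [hτ₁, hτ₂] at hor
    rw [← hor, ← marked_left, ← marked_right, hτ₁, hτ₂]
    rw [hτ₁] at hx₁
    rw [hτ₂] at hx₂
    exact ⟨rfl, rfl, rfl, hx₁, hx₂⟩
  · rintro ⟨hor', hτ₁, hτ₂, hx₁, hx₂⟩
    rw [← hor', ← marked_left] at hτ₁
    rw [← hor', ← marked_right] at hτ₂
    rw [hτ₁, hτ₂]
    exact ⟨hx₁, hx₂, rfl, rfl⟩

theorem inputs_real_preimage_fst (t : Bool) :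
    inputs.real (Prod.fst ⁻¹' {t}) = weight false t / 4 := by
  rw [← Set.prod_univ, inputs, measureReal_prod_prod, probReal_univ, mul_one]
  cases t <;> norm_num [weight, bernoulliMeasure_real_apply]

theorem card_goodSymbols_mul_prod_weight (x : Seq 3) (τ : ℕ → Bool) (n : ℕ) :
    ((goodSymbols (killed x n) (τ (2 * n + 1)) (τ (2 * n + 2)) (x (2 * n)) (x (2 * n + 1))).card /
      108 : ℝ) * ∏ m ∈ Finset.Ico n (2 * n + 1), (weight (killed x m)
        (Function.update τ n (τ (2 * n + 1) || τ (2 * n + 2)) m) / 4 : ℝ) =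
    1 / 9 * ∏ m ∈ Finset.Ico (n + 1) (2 * (n + 1) + 1), (weight (killed x m) (τ m) / 4 : ℝ) := by
  have hkilled₁ : killed x (2 * n + 1) = (killed x n || decide (x (2 * n) = 1)) := by
    rw [killed, show 2 * n / 2 = n by omega]
  have hkilled₂ : killed x (2 * n + 2) = (killed x n || decide (x (2 * n + 1) = 1)) := by
    rw [killed, show (2 * n + 1) / 2 = n by omega]
  have hrest : ∏ m ∈ Finset.Ico (n + 1) (2 * n + 1), (weight (killed x m)
      (Function.update τ n (τ (2 * n + 1) || τ (2 * n + 2)) m) / 4 : ℝ) =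
      ∏ m ∈ Finset.Ico (n + 1) (2 * n + 1), (weight (killed x m) (τ m) / 4 : ℝ) :=
    Finset.prod_congr rfl fun m hm => by rw [Function.update_of_ne (by grind)]
  rw [Finset.prod_eq_prod_Ico_succ_bot (by omega), hrest, Function.update_self,
    show 2 * (n + 1) + 1 = 2 * n + 1 + 1 + 1 by ring,
    Finset.prod_Ico_succ_top (show n + 1 ≤ 2 * n + 2 by omega),
    Finset.prod_Ico_succ_top (show n + 1 ≤ 2 * n + 1 by omega), hkilled₁, hkilled₂]
  have hcard := congrArg (Nat.cast : ℕ → ℝ) (card_goodSymbols_mul_weight (killed x n)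
    (τ (2 * n + 1)) (τ (2 * n + 2)) (x (2 * n)) (x (2 * n + 1)))
  push_cast at hcard
  linear_combination (1 / 432) * (∏ m ∈ Finset.Ico (n + 1) (2 * n + 1),
    (weight (killed x m) (τ m) / 4 : ℝ)) * hcard

theorem measureReal_frontierEvent (x : Seq 3) (τ : ℕ → Bool) (n : ℕ) :
    inputs.real (frontierEvent x τ n) =
      (1 / 9) ^ n * ∏ m ∈ Finset.Ico n (2 * n + 1), (weight (killed x m) (τ m) / 4 : ℝ) := by
  induction n generalizing τ with
  | zero =>
    have : frontierEvent x τ 0 = Prod.fst ⁻¹' {τ 0} := by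
      ext p
      simp [mem_frontierEvent_iff, marked]
    rw [this, inputs_real_preimage_fst]
    simp [killed]
  | succ n ih =>
    rw [frontierEvent_succ, measureReal_inter_preimage_finset (measurable_nextSymbols n)
      (measurableSet_frontierEvent x _ n) (measurePreserving_rotateNext n)
      (nextSymbols_rotateNext n) (preimage_rotateNext_frontierEvent x _ n), ih, mul_left_comm,
      show (Fintype.card (Fin 3 × Fin 6 × Fin 6) : ℝ) = 108 by norm_num,
      card_goodSymbols_mul_prod_weight, pow_succ, mul_assoc]

theorem measureReal_couple_prefixOf (x : Seq 3) (n : ℕ) :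
    inputs.real {p | prefixOf (couple p) (2 * n) = prefixOf x (2 * n)} = (1 / 9) ^ n := by
  let front := Finset.Ico n (2 * n + 1)
  have hunion : {p | prefixOf (couple p) (2 * n) = prefixOf x (2 * n)} =
      ⋃ s ∈ front.powerset, frontierEvent x (decide <| · ∈ s) n := by
    ext p
    simp only [Set.mem_iUnion, exists_prop, Finset.mem_powerset]
    refine ⟨fun hp => ⟨front.filter (marked p ·), Finset.filter_subset _ _, hp, fun m hm => ?_⟩,
      fun ⟨_, _, hp⟩ => hp.1⟩
    simp [show m ∈ front from hm]
  have hdisj : (front.powerset : Set (Finset ℕ)).PairwiseDisjoint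
      fun s => frontierEvent x (decide <| · ∈ s) n := by
    intro s hs t ht hst
    refine Set.disjoint_left.2 fun p hps hpt => hst ?_
    rw [Finset.mem_coe, Finset.mem_powerset] at hs ht
    refine Finset.ext fun m => ?_
    by_cases hm : m ∈ front
    · simpa using (hps.2 m hm).symm.trans (hpt.2 m hm)
    · exact iff_of_false (fun h => hm (hs h)) fun h => hm (ht h)
  rw [hunion, measureReal_biUnion_finset hdisj fun s _ => measurableSet_frontierEvent x _ n]
  have hsplit : ∀ s ∈ front.powerset, ∏ m ∈ front, (weight (killed x m) (m ∈ s) / 4 : ℝ) =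
      (∏ m ∈ s, (weight (killed x m) true / 4 : ℝ)) *
        ∏ m ∈ front \ s, (weight (killed x m) false / 4 : ℝ) := by
    intro s hs
    rw [mul_comm, ← Finset.prod_sdiff (Finset.mem_powerset.1 hs)]
    congr 1 <;> exact Finset.prod_congr rfl fun m hm => by simp_all
  have hweight (d : Bool) : (weight d true / 4 + weight d false / 4 : ℝ) = 1 := by
    cases d <;> norm_num [weight]
  simp only [measureReal_frontierEvent]
  rw [← Finset.mul_sum, Finset.sum_congr rfl hsplit, ← Finset.prod_add]
  simp [hweight]

theorem measurePreserving_couple : MeasurePreserving couple inputs (lebesgue 3) := by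
  have hmeas : Measurable couple := measurable_pi_iff.2 fun i =>
    measurable_to_countable' fun a => measurableSet_of_prefixes (i + 1) fun p q h hp => by
      rw [Set.mem_preimage, ← prefixOf_eq_iff.1 (prefixOf_couple_congr h) i i.lt_succ_self]
      exact hp
  refine ⟨hmeas, eq_lebesgue fun N => ⟨2 * N, by omega, fun x => ?_⟩⟩
  rw [Measure.map_apply hmeas (isClopen_setOf_prefixOf _ (· = _)).isOpen.measurableSet,
    ← ofReal_measureReal]
  refine (congrArg ENNReal.ofReal (measureReal_couple_prefixOf x N)).trans ?_
  rw [pow_mul, ENNReal.ofReal_pow (by norm_num), ENNReal.ofReal_div_of_pos (by norm_num),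
    ← ENNReal.inv_pow]
  norm_num

end Law

section Computability

variable {α β : Type*} [Primcodable α] [Primcodable β]

theorem primrecPred_forall_mem {f : α → List β} (hf : Primrec f) {R : β → α → Prop}
    (hR : PrimrecPred fun p : β × α => R p.1 p.2) : PrimrecPred fun a => ∀ b ∈ f a, R b a :=
  (PrimrecRel.forall_mem_list (PrimrecPred.primrecRel hR)).comp hf .id

theorem primrecPred_exists_lt {f : α → ℕ} (hf : Primrec f) {R : ℕ → α → Prop}
    (hR : PrimrecPred fun p : ℕ × α => R p.1 p.2) : PrimrecPred fun a => ∃ b < f a, R b a := by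
  simpa using (PrimrecRel.exists_mem_list (PrimrecPred.primrecRel hR)).comp
    (Primrec.list_range.comp hf) Primrec.id

theorem primrecPred_forall_lt {f : α → ℕ} (hf : Primrec f) {R : ℕ → α → Prop}
    (hR : PrimrecPred fun p : ℕ × α => R p.1 p.2) : PrimrecPred fun a => ∀ b < f a, R b a := by
  simpa using primrecPred_forall_mem (Primrec.list_range.comp hf) hR

open Classical in
theorem primrec_length_filter {f : α → List β} (hf : Primrec f) {R : β → α → Prop}
    (hR : PrimrecPred fun p : β × α => R p.1 p.2) :
    Primrec fun a => ((f a).filter fun b => R b a).length :=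
  Primrec.list_length.comp ((PrimrecRel.listFilter (PrimrecPred.primrecRel hR)).comp hf .id)

theorem primrec_list_product :
    Primrec₂ (List.product : List α → List β → List (α × β)) :=
  Primrec.list_flatMap .fst (Primrec.list_map (Primrec.snd.comp .fst)
    (Primrec₂.pair.comp (Primrec.snd.comp .fst) .snd))

theorem primrec_pow (b : ℕ) : Primrec (b ^ · : ℕ → ℕ) :=
  (Primrec.nat_rec₁ (f := fun _ m => m * b) 1 (Primrec.nat_mul.comp .snd (.const b))).of_eq
    fun n => by
      induction n with
      | zero => rfl
      | succ n ih => simp only [ih, pow_succ]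

theorem primrec_strings (n : ℕ) : Primrec (strings n) := by
  refine (Primrec.nat_rec₁ (f := fun _ L => L.flatMap fun σ => (List.finRange n).map (· :: σ))
    [[]] ?_).of_eq fun N => ?_
  · exact Primrec.list_flatMap .snd (Primrec.list_map (.const _)
      (Primrec.list_cons.comp .snd (Primrec.snd.comp .fst)))
  · induction N with
    | zero => rfl
    | succ N ih => simp only [strings, ← ih]

theorem rePred_exists {R : α → ℕ → Prop} (hR : PrimrecPred fun p : α × ℕ => R p.1 p.2) :
    REPred fun a => ∃ n, R a n := by
  classical
  have h : Partrec fun a => Nat.rfind fun n => Part.some (decide (R a n)) :=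
    Partrec.rfind hR.computablePred.decide.partrec
  exact h.dom_re.of_eq fun a => Nat.rfind_dom.trans (by simp)

theorem exists_code_of_rePred {W : α → Prop} (hW : REPred W) :
    ∃ c : Nat.Partrec.Code, ∀ a, W a ↔ (c.eval (Encodable.encode a)).Dom := by
  obtain ⟨c, hc⟩ := Nat.Partrec.Code.exists_code.1 hW
  exact ⟨c, fun a => by simp [hc, Part.assert]⟩

theorem countable_setOf_rePred : {W : α → Prop | REPred W}.Countable := by
  refine (Set.countable_range fun (c : Nat.Partrec.Code) (a : α) =>
    (c.eval (Encodable.encode a)).Dom).mono fun W hW => ?_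
  obtain ⟨c, hc⟩ := exists_code_of_rePred hW
  exact ⟨c, funext fun a => propext (hc a).symm⟩

end Computability

section Tests

variable {n : ℕ} {μ : Measure (Seq n)}

theorem exists_primrecPred_openFamily_eq {W : ℕ × List (Fin n) → Prop} (hW : REPred W) :
    ∃ R : ℕ × List (Fin n) → Prop, PrimrecPred R ∧
      (∀ i x, Monotone fun N => R (i, prefixOf x N)) ∧ openFamily R = openFamily W := by
  obtain ⟨c, hc⟩ := exists_code_of_rePred hW
  let halts (k : ℕ) (p : ℕ × List (Fin n)) : Prop := (c.evaln k (Encodable.encode p)).isSome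
  have halts_mono {k l : ℕ} (hkl : k ≤ l) (p) (h : halts k p) : halts l p := by
    obtain ⟨a, ha⟩ := Option.isSome_iff_exists.1 h
    exact Option.isSome_iff_exists.2 ⟨a, Nat.Partrec.Code.evaln_mono hkl ha⟩
  have exists_halts (p) : W p ↔ ∃ k, halts k p := by
    simp only [hc, Part.dom_iff_mem, Nat.Partrec.Code.evaln_complete, halts,
      Option.isSome_iff_exists]
    exact exists_comm
  have hR (i : ℕ) (x : Seq n) (N : ℕ) :
      (∃ m < (prefixOf x N).length + 1, halts (prefixOf x N).length (i, (prefixOf x N).take m)) ↔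
        ∃ m ≤ N, halts N (i, prefixOf x m) := by
    rw [length_prefixOf]
    refine exists_congr fun m => ?_
    rw [Nat.lt_succ_iff]
    exact and_congr_right fun hm => by rw [take_prefixOf x hm]
  refine ⟨fun p => ∃ m < p.2.length + 1, halts p.2.length (p.1, p.2.take m), ?_, ?_, ?_⟩
  · have hlen : Primrec fun p : ℕ × List (Fin n) => p.2.length := Primrec.list_length.comp .snd
    refine primrecPred_exists_lt (Primrec.succ.comp hlen) (Primrec.eq.comp
      (Primrec.option_isSome.comp (Nat.Partrec.Code.primrec_evaln.comp (.pair (.pair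
        (hlen.comp .snd) (.const c)) (Primrec.encode.comp (.pair (Primrec.fst.comp .snd)
          (Primrec.list_take.comp .fst (Primrec.snd.comp .snd))))))) (.const true))
  · intro i x M N hMN
    simp only [hR]
    exact fun ⟨m, hm, h⟩ => ⟨m, hm.trans hMN, halts_mono hMN _ h⟩
  · ext i x
    simp only [mem_openFamily, hR, exists_halts]
    exact ⟨fun ⟨N, m, _, h⟩ => ⟨m, N, h⟩, fun ⟨m, k, h⟩ =>
      ⟨m + k, m, m.le_add_right k, halts_mono (k.le_add_left m) _ h⟩⟩

theorem measure_iInter_eq_zero_of_le_pow {Ω : Type*} [MeasurableSpace Ω] {ρ : Measure Ω}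
    {A : ℕ → Set Ω} (h : ∀ᶠ i in Filter.atTop, ρ (A i) ≤ (2 : ℝ≥0∞)⁻¹ ^ i) :
    ρ (⋂ i, A i) = 0 :=
  le_antisymm (ge_of_tendsto
    (ENNReal.tendsto_pow_atTop_nhds_zero_of_lt_one ENNReal.one_half_lt_one)
    (h.mono fun i hi => (measure_mono (Set.iInter_subset A i)).trans hi)) bot_le

theorem ae_mem_MLR_of_forall_isMLTest {Ω : Type*} [MeasurableSpace Ω] {ρ : Measure Ω}
    {f : Ω → Seq n} (h : ∀ W, IsMLTest μ W → ∀ᵐ ω ∂ρ, f ω ∉ ⋂ i, openFamily W i) :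
    ∀ᵐ ω ∂ρ, f ω ∈ MLR μ := by
  have hcount : {W | IsMLTest μ W}.Countable := countable_setOf_rePred.mono fun W hW => hW.1
  exact (ae_ball_iff hcount).2 h

theorem ae_mem_MLR : ∀ᵐ x ∂μ, x ∈ MLR μ :=
  ae_mem_MLR_of_forall_isMLTest fun _ hW => measure_eq_zero_iff_ae_notMem.1
    (measure_iInter_eq_zero_of_le_pow (.of_forall hW.2))

theorem tsum_inv_two_pow_add (i : ℕ) : ∑' k, (2 : ℝ≥0∞)⁻¹ ^ (i + 1 + k) = 2⁻¹ ^ i := by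
  simp only [pow_add _ (i + 1), ENNReal.tsum_mul_left, ENNReal.tsum_geometric_two]
  rw [pow_succ, mul_assoc, ENNReal.inv_mul_cancel two_ne_zero ENNReal.ofNat_ne_top, mul_one]

theorem eventually_notMem_openFamily {x : Seq n} (hx : x ∈ MLR μ) {R : ℕ × List (Fin n) → Prop}
    (hR : PrimrecPred R) (hle : ∀ i, μ (openFamily R i) ≤ (2 : ℝ≥0∞)⁻¹ ^ i) :
    ∀ᶠ i in Filter.atTop, x ∉ openFamily R i := by
  have htest : IsMLTest μ fun p => ∃ k, R (p.1 + 1 + k, p.2) := by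
    refine ⟨rePred_exists (hR.comp (.pair (Primrec.nat_add.comp (Primrec.succ.comp
      (Primrec.fst.comp .fst)) .snd) (Primrec.snd.comp .fst))), fun i => ?_⟩
    have hsub : openFamily (fun p => ∃ k, R (p.1 + 1 + k, p.2)) i ⊆
        ⋃ k, openFamily R (i + 1 + k) := by
      rintro y ⟨σ, ⟨k, hk⟩, hy⟩
      exact Set.mem_iUnion.2 ⟨k, σ, hk, hy⟩
    calc μ (openFamily (fun p => ∃ k, R (p.1 + 1 + k, p.2)) i)
        ≤ ∑' k, μ (openFamily R (i + 1 + k)) := (measure_mono hsub).trans (measure_iUnion_le _)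
      _ ≤ ∑' k, 2⁻¹ ^ (i + 1 + k) := ENNReal.tsum_le_tsum fun k => hle _
      _ = 2⁻¹ ^ i := tsum_inv_two_pow_add i
  obtain ⟨i, hi⟩ := not_forall.1 (mt Set.mem_iInter.2 (hx _ htest))
  filter_upwards [Filter.eventually_gt_atTop i] with j hj ⟨σ, hσ, hxσ⟩
  exact hi ⟨σ, ⟨j - (i + 1), by rwa [Nat.add_sub_cancel' hj]⟩, hxσ⟩

end Tests

section Tails

variable {n : ℕ} [NeZero n] {S : Finset (Fin n)}

/-- A test against `HasTailIn S`. Nodes are numbered from `1` here, so that `v / 2` is the parent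
of `v` and the label of `v` is the symbol number `v - 2`. At level `i`, the test looks for a node
`v` such that all labels on the path from its ancestor `q = v / 2 ^ s` to `v`, except that of `q`,
are in `S`. The length `s = 2 * (q + i)` makes the measures of these events summable. -/
def tailTest (S : Finset (Fin n)) (p : ℕ × List (Fin n)) : Prop :=
  ∃ v < p.2.length + 2, ∃ s < v, (s = 2 * (v / 2 ^ s + p.1) ∧ 2 ^ s ≤ v) ∧
    ∀ j < s, p.2.getD (v / 2 ^ j - 2) 0 ∈ S

theorem primrecPred_tailTest (S : Finset (Fin n)) : PrimrecPred (tailTest S) := by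
  have hlabel : PrimrecPred fun w : ℕ × ℕ × ℕ × ℕ × List (Fin n) =>
      w.2.2.2.2.getD (w.2.2.1 / 2 ^ w.1 - 2) 0 ∈ S := by
    have hS : PrimrecPred (· ∈ S) := (Primrec.dom_finite _).primrecPred
    exact hS.comp ((Primrec.list_getD 0).comp
      (Primrec.snd.comp (Primrec.snd.comp (Primrec.snd.comp .snd)))
      (Primrec.nat_sub.comp (Primrec.nat_div.comp (Primrec.fst.comp (Primrec.snd.comp .snd))
        ((primrec_pow 2).comp .fst)) (.const 2)))
  have hbounds : PrimrecPred fun w : ℕ × ℕ × ℕ × List (Fin n) =>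
      w.1 = 2 * (w.2.1 / 2 ^ w.1 + w.2.2.1) ∧ 2 ^ w.1 ≤ w.2.1 := by
    have hpow : Primrec fun w : ℕ × ℕ × ℕ × List (Fin n) => 2 ^ w.1 := (primrec_pow 2).comp .fst
    have hv : Primrec fun w : ℕ × ℕ × ℕ × List (Fin n) => w.2.1 := Primrec.fst.comp .snd
    exact (Primrec.eq.comp .fst (Primrec.nat_mul.comp (.const 2) (Primrec.nat_add.comp
      (Primrec.nat_div.comp hv hpow) (Primrec.fst.comp (Primrec.snd.comp .snd))))).and
      (Primrec.nat_le.comp hpow hv)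
  exact primrecPred_exists_lt
    (Primrec.nat_add.comp (Primrec.list_length.comp .snd) (.const 2))
    (primrecPred_exists_lt .fst (hbounds.and (primrecPred_forall_lt .fst hlabel)))

theorem mem_openFamily_tailTest {i : ℕ} {x : Seq n} : x ∈ openFamily (tailTest S) i ↔
    ∃ v s, (s = 2 * (v / 2 ^ s + i) ∧ 2 ^ s ≤ v) ∧ ∀ j < s, x (v / 2 ^ j - 2) ∈ S := by
  have hlabel (N v : ℕ) (hv : v < N + 2) (j : ℕ) (hj : 2 ^ j < v) :
      (prefixOf x N).getD (v / 2 ^ j - 2) 0 = x (v / 2 ^ j - 2) :=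
    getD_prefixOf x 0 (by
      have := Nat.div_le_self v (2 ^ j)
      have := Nat.two_pow_pos j
      omega)
  rw [mem_openFamily]
  constructor
  · rintro ⟨N, v, hv, s, -, ⟨hs, hsv⟩, h⟩
    rw [length_prefixOf] at hv
    exact ⟨v, s, ⟨hs, hsv⟩, fun j hj => hlabel N v hv j
      ((Nat.pow_lt_pow_right one_lt_two hj).trans_le hsv) ▸ h j hj⟩
  · rintro ⟨v, s, ⟨hs, hsv⟩, h⟩
    exact ⟨v, v, by simp, s, s.lt_two_pow_self.trans_le hsv, ⟨hs, hsv⟩, fun j hj =>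
      (hlabel v v (by omega) j ((Nat.pow_lt_pow_right one_lt_two hj).trans_le hsv)).symm ▸ h j hj⟩

theorem lebesgue_setOf_forall_ancestor {v s : ℕ} (h : 2 ^ s ≤ v) :
    lebesgue n {x | ∀ j < s, x (v / 2 ^ j - 2) ∈ S} = (S.card / n) ^ s := by
  have htwo {j : ℕ} (hj : j < s) : 2 ≤ v / 2 ^ j :=
    (Nat.le_div_iff_mul_le (by positivity)).2
      ((pow_succ' 2 j ▸ Nat.pow_le_pow_right two_pos hj).trans h)
  have hanti : StrictAntiOn (fun j => v / 2 ^ j - 2) (Finset.range s) := by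
    intro j hj j' hj' hlt
    simp only [Finset.coe_range, Set.mem_Iio] at hj hj'
    have hparent : v / 2 ^ j' ≤ v / 2 ^ j / 2 := by
      rw [Nat.div_div_eq_div_mul, ← pow_succ]
      exact Nat.div_le_div_left (Nat.pow_le_pow_right two_pos hlt) (by positivity)
    have := htwo hj
    have := htwo hj'
    simp only
    omega
  have := lebesgue_setOf_forall_mem ((Finset.range s).image fun j => v / 2 ^ j - 2) fun _ => S
  simpa [Finset.card_image_of_injOn hanti.injOn] using this

theorem four_mul_div_sq_le {c : ℕ} (h : 3 * c ≤ n) : 4 * (c / n : ℝ≥0∞) ^ 2 ≤ 2⁻¹ := by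
  have hpos : (0 : ℝ) < n := by exact_mod_cast NeZero.pos n
  have hreal : 4 * (c / n : ℝ) ^ 2 ≤ 2⁻¹ := by
    have hle : 3 * (c : ℝ) ≤ n := by exact_mod_cast h
    rw [div_pow, ← mul_div_assoc, div_le_iff₀ (by positivity)]
    nlinarith
  have := ENNReal.ofReal_le_ofReal hreal
  rwa [ENNReal.ofReal_mul (by norm_num), ENNReal.ofReal_pow (by positivity),
    ENNReal.ofReal_div_of_pos hpos, ENNReal.ofReal_inv_of_pos two_pos, ENNReal.ofReal_natCast,
    ENNReal.ofReal_natCast, ENNReal.ofReal_ofNat, ENNReal.ofReal_ofNat] at this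

theorem lebesgue_openFamily_tailTest_le (hS : 3 * S.card ≤ n) (i : ℕ) :
    lebesgue n (openFamily (tailTest S) i) ≤ 2⁻¹ ^ i := by
  let s (q : ℕ) : ℕ := 2 * (q + 1 + i)
  let A (q t : ℕ) : Set (Seq n) := {x | ∀ j < s q, x (((q + 1) * 2 ^ s q + t) / 2 ^ j - 2) ∈ S}
  have hcover : openFamily (tailTest S) i ⊆ ⋃ q, ⋃ t ∈ Finset.range (2 ^ s q), A q t := by
    intro x hx
    obtain ⟨v, r, ⟨hr, hrv⟩, h⟩ := mem_openFamily_tailTest.1 hx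
    have hpos : 0 < v / 2 ^ r := Nat.div_pos hrv (by positivity)
    have hrs : r = s (v / 2 ^ r - 1) := by
      simp only [s]
      omega
    refine Set.mem_iUnion.2 ⟨v / 2 ^ r - 1, Set.mem_iUnion₂.2
      ⟨v % 2 ^ r, Finset.mem_range.2 (hrs ▸ Nat.mod_lt v (by positivity)), fun j hj => ?_⟩⟩
    rw [← hrs] at hj ⊢
    rw [Nat.sub_add_cancel hpos, Nat.div_add_mod']
    exact h j hj
  have hlevel (q : ℕ) : lebesgue n (⋃ t ∈ Finset.range (2 ^ s q), A q t) ≤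
      2⁻¹ ^ (i + 1 + q) := calc
    _ ≤ ∑ t ∈ Finset.range (2 ^ s q), lebesgue n (A q t) := measure_biUnion_finset_le _ _
    _ = 2 ^ s q * (S.card / n) ^ s q := by
      rw [Finset.sum_congr rfl fun t _ => lebesgue_setOf_forall_ancestor
        ((Nat.le_mul_of_pos_left _ q.succ_pos).trans (Nat.le_add_right _ t))]
      simp
    _ = (4 * (S.card / n : ℝ≥0∞) ^ 2) ^ (i + 1 + q) := by
      rw [show s q = 2 * (i + 1 + q) by grind, ← mul_pow, pow_mul, mul_pow]
      norm_num
    _ ≤ 2⁻¹ ^ (i + 1 + q) := pow_le_pow_left₀ bot_le (four_mul_div_sq_le hS) _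
  calc lebesgue n (openFamily (tailTest S) i)
      ≤ ∑' q, lebesgue n (⋃ t ∈ Finset.range (2 ^ s q), A q t) :=
        (measure_mono hcover).trans (measure_iUnion_le _)
    _ ≤ ∑' q, 2⁻¹ ^ (i + 1 + q) := ENNReal.tsum_le_tsum hlevel
    _ = 2⁻¹ ^ i := tsum_inv_two_pow_add i

theorem isMLTest_tailTest (hS : 3 * S.card ≤ n) : IsMLTest (lebesgue n) (tailTest S) :=
  ⟨(primrecPred_tailTest S).computablePred.to_re, lebesgue_openFamily_tailTest_le hS⟩

theorem mem_openFamily_tailTest_of_hasTailIn {x : Seq n} (h : HasTailIn S x) (i : ℕ) :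
    x ∈ openFamily (tailTest S) i := by
  obtain ⟨y, hy⟩ := h
  obtain ⟨k, hk⟩ := Filter.eventually_atTop.1 hy
  let s := 2 * (node y k + 1 + i)
  have hs : (node y (k + s) + 1) / 2 ^ s = node y k + 1 := node_add_add_one_div y k s
  refine mem_openFamily_tailTest.2 ⟨node y (k + s) + 1, s, ⟨by rw [hs], ?_⟩, fun j hj => ?_⟩
  · exact (Nat.div_pos_iff.1 (hs ▸ Nat.succ_pos _)).2
  · have hnode : (node y (k + s) + 1) / 2 ^ j = node y (k + (s - j - 1) + 1) + 1 := by
      rw [show k + s = k + (s - j - 1) + 1 + j by omega, node_add_add_one_div]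
    have hlabel := hk (k + (s - j - 1)) (by omega)
    rw [hnode, node]
    exact hlabel

theorem not_hasTailIn_of_mem_MLR (hS : 3 * S.card ≤ n) {x : Seq n} (hx : x ∈ MLR (lebesgue n)) :
    ¬ HasTailIn S x := fun h =>
  hx _ (isMLTest_tailTest hS) (Set.mem_iInter.2 (mem_openFamily_tailTest_of_hasTailIn h))

end Tails

section Pullback

variable {γ : Type*} {m l k : ℕ}

/-- The prefixes of the values of `Φ` are computed by a primitive recursive function from the
prefixes of the same length of its arguments. -/
def IsPrimrecNonexpansive [Primcodable γ] (Φ : γ × Seq m × Seq l → Seq k) : Prop :=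
  ∃ φ : γ × List (Fin m) × List (Fin l) → List (Fin k), Primrec φ ∧
    ∀ p N, prefixOf (Φ p) N = φ (prefixes p N)

/-- The possible values of `prefixes p N`; see `mem_allPrefixes`. -/
noncomputable def allPrefixes (γ : Type*) [Fintype γ] (m l N : ℕ) :
    List (γ × List (Fin m) × List (Fin l)) :=
  Finset.univ.toList.product ((strings m N).product (strings l N))

/-- A test for values of a function that covers `x` if it covers each `p` with value `x` in one of
its two sequences by a given test; see `mem_openFamily_pullbackTest`. -/
def pullbackTest [Fintype γ] (φ : γ × List (Fin m) × List (Fin l) → List (Fin k))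
    (W : ℕ × List (Fin m) → Prop) (V : ℕ × List (Fin l) → Prop) (q : ℕ × List (Fin k)) : Prop :=
  ∀ t ∈ allPrefixes γ m l q.2.length, φ t = q.2 → W (q.1 + 1, t.2.1) ∨ V (q.1 + 1, t.2.2)

theorem mem_allPrefixes [NeZero m] [NeZero l] [Fintype γ] {N : ℕ}
    {t : γ × List (Fin m) × List (Fin l)} : t ∈ allPrefixes γ m l N ↔ ∃ p, prefixes p N = t := by
  obtain ⟨c, ζ, ρ⟩ := t
  simp only [allPrefixes, List.pair_mem_product, Finset.mem_toList, Finset.mem_univ, true_and,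
    mem_strings]
  constructor
  · rintro ⟨hζ, hρ⟩
    refine ⟨(c, ofList ζ, ofList ρ), ?_⟩
    rw [prefixes, ← hζ, prefixOf_ofList, hζ, ← hρ, prefixOf_ofList]
  · rintro ⟨p, h⟩
    simp only [prefixes, Prod.mk.injEq] at h
    simp [← h.2.1, ← h.2.2]

theorem primrec_allPrefixes [Primcodable γ] [Fintype γ] : Primrec (allPrefixes γ m l) :=
  primrec_list_product.comp (.const _)
    (primrec_list_product.comp (primrec_strings m) (primrec_strings l))

theorem primrecPred_pullbackTest [Primcodable γ] [Fintype γ]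
    {φ : γ × List (Fin m) × List (Fin l) → List (Fin k)} (hφ : Primrec φ)
    {W : ℕ × List (Fin m) → Prop} (hW : PrimrecPred W)
    {V : ℕ × List (Fin l) → Prop} (hV : PrimrecPred V) :
    PrimrecPred (pullbackTest φ W V) := by
  refine primrecPred_forall_mem (primrec_allPrefixes.comp (Primrec.list_length.comp .snd)) ?_
  have hlevel : Primrec
      fun v : (γ × List (Fin m) × List (Fin l)) × ℕ × List (Fin k) => v.2.1 + 1 :=
    Primrec.succ.comp (Primrec.fst.comp .snd)
  have hvalue := Primrec.eq.comp (hφ.comp (Primrec.fst (β := ℕ × List (Fin k))))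
    (Primrec.snd.comp .snd)
  have hcover := (hW.comp (hlevel.pair (Primrec.fst.comp (Primrec.snd.comp .fst)))).or
    (hV.comp (hlevel.pair (Primrec.snd.comp (Primrec.snd.comp .fst))))
  exact (hvalue.not.or hcover).of_eq fun v => imp_iff_not_or.symm

variable [NeZero m] [NeZero l] {W : ℕ × List (Fin m) → Prop} {V : ℕ × List (Fin l) → Prop}
  {Φ : γ × Seq m × Seq l → Seq k} {φ : γ × List (Fin m) × List (Fin l) → List (Fin k)}

theorem mem_openFamily_pullbackTest [Fintype γ]
    (hWmono : ∀ i z, Monotone fun N => W (i, prefixOf z N))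
    (hVmono : ∀ i r, Monotone fun N => V (i, prefixOf r N))
    (hφ : ∀ p N, prefixOf (Φ p) N = φ (prefixes p N)) {i : ℕ} {x : Seq k} :
    x ∈ openFamily (pullbackTest φ W V) i ↔
      ∀ p, Φ p = x → p.2.1 ∈ openFamily W (i + 1) ∨ p.2.2 ∈ openFamily V (i + 1) := by
  let _ : TopologicalSpace γ := ⊥
  have _ : DiscreteTopology γ := ⟨rfl⟩
  let K (N : ℕ) : Set (γ × Seq m × Seq l) := {p | φ (prefixes p N) = prefixOf x N ∧
    ¬ (W (i + 1, (prefixes p N).2.1) ∨ V (i + 1, (prefixes p N).2.2))}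
  have hK (N : ℕ) : pullbackTest φ W V (i, prefixOf x N) ↔ ¬ (K N).Nonempty := by
    simp only [pullbackTest, length_prefixOf, mem_allPrefixes, forall_exists_index,
      forall_apply_eq_imp_iff, Set.not_nonempty_iff_eq_empty,
      Set.eq_empty_iff_forall_notMem, K, Set.mem_ofPred_eq, not_and, not_not]
  have hanti (N : ℕ) : K (N + 1) ⊆ K N := by
    rintro p ⟨heq, hnot⟩
    rw [← hφ, prefixOf_eq_iff] at heq
    refine ⟨?_, mt (Or.imp (hWmono _ _ N.le_succ) (hVmono _ _ N.le_succ)) hnot⟩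
    rw [← hφ, prefixOf_eq_iff]
    exact fun j hj => heq j (hj.trans N.lt_succ_self)
  have hclosed (N : ℕ) : IsClosed (K N) :=
    (isClopen_of_prefixes N fun p q hpq (hp : _ ∧ _) => show _ ∧ _ from hpq ▸ hp).isClosed
  simp only [mem_openFamily, hK]
  constructor
  · rintro ⟨N, hN⟩ p rfl
    by_contra! hp
    exact hN ⟨p, (hφ p N).symm, not_or.2 ⟨hp.1 N, hp.2 N⟩⟩
  · intro h
    by_contra! hne
    obtain ⟨p, hp⟩ := IsCompact.nonempty_iInter_of_sequence_nonempty_isCompact_isClosed K hanti hne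
      (hclosed 0).isCompact hclosed
    rw [Set.mem_iInter] at hp
    have hpx : Φ p = x := funext fun j =>
      prefixOf_eq_iff.1 ((hφ p (j + 1)).trans (hp (j + 1)).1) j j.lt_succ_self
    rcases h p hpx with ⟨N, hN⟩ | ⟨N, hN⟩
    · exact (hp N).2 (.inl hN)
    · exact (hp N).2 (.inr hN)

theorem isMLTest_pullbackTest [Primcodable γ] [Fintype γ] [MeasurableSpace γ]
    {π : Measure γ} {ν : Measure (Seq m)} {ρ : Measure (Seq l)} {μ : Measure (Seq k)}
    [IsProbabilityMeasure π] [IsProbabilityMeasure ν] [IsProbabilityMeasure ρ]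
    (hΦ : MeasurePreserving Φ (π.prod (ν.prod ρ)) μ) (hφ : Primrec φ)
    (hΦφ : ∀ p N, prefixOf (Φ p) N = φ (prefixes p N))
    (hWmono : ∀ i z, Monotone fun N => W (i, prefixOf z N)) (hW : PrimrecPred W)
    (hWle : ∀ i, ν (openFamily W i) ≤ 2⁻¹ ^ i)
    (hVmono : ∀ i r, Monotone fun N => V (i, prefixOf r N)) (hV : PrimrecPred V)
    (hVle : ∀ i, ρ (openFamily V i) ≤ 2⁻¹ ^ i) : IsMLTest μ (pullbackTest φ W V) := by
  refine ⟨(primrecPred_pullbackTest hφ hW hV).computablePred.to_re, fun i => ?_⟩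
  have hsub : Φ ⁻¹' openFamily (pullbackTest φ W V) i ⊆
      Set.univ ×ˢ (openFamily W (i + 1) ×ˢ Set.univ) ∪
        Set.univ ×ˢ (Set.univ ×ˢ openFamily V (i + 1)) := fun p hp => by
    simpa using (mem_openFamily_pullbackTest hWmono hVmono hΦφ).1 hp p rfl
  rw [← hΦ.measure_preimage (isOpen_openFamily _ _).measurableSet.nullMeasurableSet]
  calc _ ≤ _ := (measure_mono hsub).trans (measure_union_le _ _)
    _ = ν (openFamily W (i + 1)) + ρ (openFamily V (i + 1)) := by
      simp only [Measure.prod_prod, measure_univ, one_mul, mul_one]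
    _ ≤ 2⁻¹ ^ (i + 1) + 2⁻¹ ^ (i + 1) := add_le_add (hWle _) (hVle _)
    _ = 2⁻¹ ^ i := by rw [pow_succ, ← mul_add, ENNReal.inv_two_add_inv_two, mul_one]

theorem exists_eq_of_mem_MLR [Primcodable γ] [Finite γ] [MeasurableSpace γ]
    {π : Measure γ} {ν : Measure (Seq m)} {ρ : Measure (Seq l)} {μ : Measure (Seq k)}
    [IsProbabilityMeasure π] [IsProbabilityMeasure ν] [IsProbabilityMeasure ρ]
    (hΦ : MeasurePreserving Φ (π.prod (ν.prod ρ)) μ) (hΦprim : IsPrimrecNonexpansive Φ)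
    {x : Seq k} (hx : x ∈ MLR μ) (hW : IsMLTest ν W) (hV : IsMLTest ρ V) :
    ∃ p, Φ p = x ∧ p.2.1 ∉ ⋂ i, openFamily W i ∧ p.2.2 ∉ ⋂ i, openFamily V i := by
  have := Fintype.ofFinite γ
  obtain ⟨φ, hφ, hΦφ⟩ := hΦprim
  obtain ⟨W', hW', hWmono, hWW'⟩ := exists_primrecPred_openFamily_eq hW.1
  obtain ⟨V', hV', hVmono, hVV'⟩ := exists_primrecPred_openFamily_eq hV.1
  have htest : IsMLTest μ (pullbackTest φ W' V') := isMLTest_pullbackTest hΦ hφ hΦφ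
    hWmono hW' (fun i => hWW' ▸ hW.2 i) hVmono hV' (fun i => hVV' ▸ hV.2 i)
  obtain ⟨i, hi⟩ := not_forall.1 (mt Set.mem_iInter.2 (hx _ htest))
  rw [mem_openFamily_pullbackTest hWmono hVmono hΦφ, hWW', hVV'] at hi
  push Not at hi
  obtain ⟨p, hpx, hpW, hpV⟩ := hi
  exact ⟨p, hpx, fun h => hpW (Set.mem_iInter.1 h _), fun h => hpV (Set.mem_iInter.1 h _)⟩

end Pullback

section Pushforward

variable {γ : Type*} {m l k : ℕ}

open Classical in
/-- A test for the second component of an argument of a function with first component `c`: it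
covers those components that a given test for the values of the function covers for a large set of
third components, `φ` computing prefixes of values from prefixes of arguments. See
`mem_openFamily_heavyTest`. -/
def heavyTest (φ : γ × List (Fin m) × List (Fin l) → List (Fin k)) (c : γ) (d : ℕ)
    (W : ℕ × List (Fin k) → Prop) (p : ℕ × List (Fin m)) : Prop :=
  l ^ p.2.length < 2 ^ p.1 *
    ((strings l p.2.length).filter fun ρ => W (2 * p.1 + d, φ (c, p.2, ρ))).length

variable {φ : γ × List (Fin m) × List (Fin l) → List (Fin k)} {c : γ} {d : ℕ}
  {W : ℕ × List (Fin k) → Prop} {Φ : γ × Seq m × Seq l → Seq k}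

theorem primrecPred_heavyTest [Primcodable γ] (hφ : Primrec φ) (c : γ) (d : ℕ)
    (hW : PrimrecPred W) : PrimrecPred (heavyTest φ c d W) := by
  have hlen : Primrec fun p : ℕ × List (Fin m) => p.2.length := Primrec.list_length.comp .snd
  have hvalue := hφ.comp (.pair (.const c)
    (.pair (Primrec.snd.comp (Primrec.snd (α := List (Fin l)) (β := ℕ × List (Fin m)))) .fst))
  have hlevel : Primrec fun v : List (Fin l) × ℕ × List (Fin m) => 2 * v.2.1 + d :=
    Primrec.nat_add.comp (Primrec.nat_mul.comp (.const 2) (Primrec.fst.comp .snd)) (.const d)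
  have hcount := primrec_length_filter (R := fun ρ p => W (2 * p.1 + d, φ (c, p.2, ρ)))
    ((primrec_strings l).comp hlen) (hW.comp (hlevel.pair hvalue))
  exact Primrec.nat_lt.comp ((primrec_pow l).comp hlen)
    (Primrec.nat_mul.comp ((primrec_pow 2).comp .fst) hcount)

theorem heavyTest_prefixOf [NeZero l] (hφ : ∀ p N, prefixOf (Φ p) N = φ (prefixes p N))
    {i N : ℕ} {z : Seq m} : heavyTest φ c d W (i, prefixOf z N) ↔
      (2 : ℝ≥0∞)⁻¹ ^ i < lebesgue l {r | W (2 * i + d, prefixOf (Φ (c, z, r)) N)} := by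
  simp only [hφ, prefixes]
  rw [lebesgue_setOf_prefixOf N fun ρ => W (2 * i + d, φ (c, prefixOf z N, ρ))]
  simp only [heavyTest, length_prefixOf]
  generalize (List.filter _ _).length = q
  rw [← ENNReal.inv_pow, ← ENNReal.inv_pow, ← div_eq_mul_inv,
    ENNReal.lt_div_iff_mul_lt (by simp) (by simp), mul_comm _⁻¹, ← div_eq_mul_inv,
    ENNReal.div_lt_iff (by simp) (by simp), mul_comm _ q]
  exact_mod_cast Iff.rfl

theorem mem_openFamily_heavyTest [NeZero l] (hφ : ∀ p N, prefixOf (Φ p) N = φ (prefixes p N))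
    (hW : ∀ i x, Monotone fun N => W (i, prefixOf x N)) {i : ℕ} {z : Seq m} :
    z ∈ openFamily (heavyTest φ c d W) i ↔
      (2 : ℝ≥0∞)⁻¹ ^ i < lebesgue l {r | Φ (c, z, r) ∈ openFamily W (2 * i + d)} := by
  have hmono : Monotone fun N => {r | W (2 * i + d, prefixOf (Φ (c, z, r)) N)} :=
    fun _ _ h r => hW _ (Φ (c, z, r)) h
  have hunion : {r | Φ (c, z, r) ∈ openFamily W (2 * i + d)} =
      ⋃ N, {r | W (2 * i + d, prefixOf (Φ (c, z, r)) N)} := by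
    ext r
    simp only [mem_openFamily, Set.mem_iUnion, Set.mem_ofPred_eq]
  rw [mem_openFamily, hunion, hmono.measure_iUnion, lt_iSup_iff]
  simp only [heavyTest_prefixOf hφ]

variable [MeasurableSpace γ] {π : Measure γ} {ν : Measure (Seq m)}
  {μ : Measure (Seq k)} [SFinite ν] [NeZero l]

theorem measure_openFamily_heavyTest_le
    (hφ : ∀ p N, prefixOf (Φ p) N = φ (prefixes p N))
    (hΦ : MeasurePreserving Φ (π.prod (ν.prod (lebesgue l))) μ) (hd : 2⁻¹ ^ d ≤ π {c})
    (hW : ∀ i x, Monotone fun N => W (i, prefixOf x N))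
    (hWle : ∀ i, μ (openFamily W i) ≤ 2⁻¹ ^ i) (i : ℕ) :
    ν (openFamily (heavyTest φ c d W) i) ≤ 2⁻¹ ^ i := by
  set B : Set (Seq m × Seq l) := {q | Φ (c, q) ∈ openFamily W (2 * i + d)}
  have hU : MeasurableSet (openFamily W (2 * i + d)) := (isOpen_openFamily _ _).measurableSet
  have hB : MeasurableSet B := (hΦ.measurable.comp measurable_prodMk_left) hU
  have hlight : 2⁻¹ ^ d * ν.prod (lebesgue l) B ≤ 2⁻¹ ^ d * (2⁻¹ ^ i * 2⁻¹ ^ i) := by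
    calc 2⁻¹ ^ d * ν.prod (lebesgue l) B ≤ π {c} * ν.prod (lebesgue l) B := by gcongr
      _ = π.prod (ν.prod (lebesgue l)) ({c} ×ˢ B) := (Measure.prod_prod _ _).symm
      _ ≤ π.prod (ν.prod (lebesgue l)) (Φ ⁻¹' openFamily W (2 * i + d)) :=
        measure_mono fun p ⟨hp, hpB⟩ => by
          obtain ⟨_, q⟩ := p
          obtain rfl : _ = c := hp
          exact hpB
      _ = μ (openFamily W (2 * i + d)) := hΦ.measure_preimage hU.nullMeasurableSet
      _ ≤ 2⁻¹ ^ (2 * i + d) := hWle _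
      _ = 2⁻¹ ^ d * (2⁻¹ ^ i * 2⁻¹ ^ i) := by ring
  have hmarkov : 2⁻¹ ^ i * ν (openFamily (heavyTest φ c d W) i) ≤ 2⁻¹ ^ i * 2⁻¹ ^ i := by
    calc 2⁻¹ ^ i * ν (openFamily (heavyTest φ c d W) i)
        ≤ 2⁻¹ ^ i * ν {z | 2⁻¹ ^ i ≤ lebesgue l (Prod.mk z ⁻¹' B)} := by
          gcongr
          exact fun z hz => ((mem_openFamily_heavyTest hφ hW).1 hz).le
      _ ≤ ∫⁻ z, lebesgue l (Prod.mk z ⁻¹' B) ∂ν :=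
        mul_meas_ge_le_lintegral (measurable_measure_prodMk_left hB) _
      _ = ν.prod (lebesgue l) B := (Measure.prod_apply hB).symm
      _ ≤ 2⁻¹ ^ i * 2⁻¹ ^ i := (ENNReal.mul_le_mul_iff_right (by simp) (by simp)).1 hlight
  exact (ENNReal.mul_le_mul_iff_right (by simp) (by simp)).1 hmarkov

theorem ae_mem_MLR_of_mem_MLR [Primcodable γ]
    (hΦ : MeasurePreserving Φ (π.prod (ν.prod (lebesgue l))) μ)
    (hΦprim : IsPrimrecNonexpansive Φ) (hc : π {c} ≠ 0) {z : Seq m} (hz : z ∈ MLR ν) :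
    ∀ᵐ r ∂lebesgue l, Φ (c, z, r) ∈ MLR μ := by
  obtain ⟨φ, hφ, hΦφ⟩ := hΦprim
  obtain ⟨d, hd⟩ := ENNReal.exists_inv_two_pow_lt hc
  refine ae_mem_MLR_of_forall_isMLTest fun W hW => ?_
  obtain ⟨W', hW', hmono, hWW'⟩ := exists_primrecPred_openFamily_eq hW.1
  rw [← hWW']
  have hlight := eventually_notMem_openFamily hz (primrecPred_heavyTest hφ c d hW')
    (measure_openFamily_heavyTest_le hΦφ hΦ hd.le hmono fun i => hWW' ▸ hW.2 i)
  refine measure_mono_null (fun r hr => ?_) (measure_iInter_eq_zero_of_le_pow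
    (A := fun i => {r | Φ (c, z, r) ∈ openFamily W' (2 * i + d)}) (hlight.mono fun i hi => ?_))
  · exact Set.mem_iInter.2 fun i => Set.mem_iInter.1 (not_not.1 hr) _
  · exact not_lt.1 (mt (mem_openFamily_heavyTest hΦφ hmono).2 hi)

end Pushforward

section CouplingComputability

theorem prefixOf_eq_map {n : ℕ} (x : Seq n) (N : ℕ) : prefixOf x N = (List.range N).map x :=
  List.ext_getElem (by simp) fun i _ _ => by simp [prefixOf]

theorem getD_map_range {α : Type*} (f : ℕ → α) {m n : ℕ} (h : m < n) (d : α) :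
    ((List.range n).map f).getD m d = f m := by
  simp [List.getD_eq_getElem?_getD, h]

theorem rank_eq_length_filter (z : Seq 3) {m n : ℕ} (h : m ≤ n) :
    rank z m = ((((List.range n).map (nodeInTree z)).take m).filter (· = true)).length := by
  rw [← List.map_take, List.take_range, min_eq_left h, rank, Nat.count,
    List.countP_eq_length_filter, List.filter_map, List.length_map]
  rfl

theorem primrec_nodeInTree :
    Primrec₂ fun (σ : List (Fin 3)) (n : ℕ) => nodeInTree (ofList σ) n := by
  let parent (L : List Bool) : ℕ := (L.length - 1) / 2
  let symbol (σ : List (Fin 3)) (L : List Bool) : Fin 3 :=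
    σ.getD ((L.take (parent L)).filter (· = true)).length 0
  refine Primrec.nat_strong_rec _ (g := fun σ L => some (if L.length = 0 then true else
    L.getD (parent L) false &&
      decide ((symbol σ L : ℕ) = (L.length - 1) % 2 ∨ symbol σ L = 2))) ?_ ?_
  · have hlength : Primrec fun v : List (Fin 3) × List Bool => v.2.length :=
      Primrec.list_length.comp .snd
    have hpred := Primrec.nat_sub.comp hlength (.const 1)
    have hparent : Primrec fun v : List (Fin 3) × List Bool => parent v.2 :=
      Primrec.nat_div.comp hpred (.const 2)
    have hsymbol : Primrec fun v : List (Fin 3) × List Bool => symbol v.1 v.2 :=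
      (Primrec.list_getD 0).comp .fst (Primrec.list_length.comp
        ((Primrec.listFilter (Primrec.eq.comp .id (.const true))).comp
          (Primrec.list_take.comp hparent .snd)))
    exact Primrec.option_some.comp (Primrec.ite (Primrec.eq.comp hlength (.const 0)) (.const true)
      (Primrec.and.comp ((Primrec.list_getD false).comp .snd hparent) (PrimrecPred.decide
        ((Primrec.eq.comp (Primrec.fin_val.comp hsymbol) (Primrec.nat_mod.comp hpred
          (.const 2))).or (Primrec.eq.comp hsymbol (.const 2))))))
  · rintro σ (_ | n)
    · simp
    · have hparent : parent ((List.range (n + 1)).map (nodeInTree (ofList σ))) = n / 2 := by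
        simp [parent]
      have hsymbol : symbol σ ((List.range (n + 1)).map (nodeInTree (ofList σ))) =
          ofList σ (rank (ofList σ) (n / 2)) := by
        simp only [symbol, hparent]
        rw [← rank_eq_length_filter _ (by omega), ofList]
      simp only [hparent, hsymbol]
      rw [getD_map_range _ (by omega), nodeInTree_succ]
      simp

/-- The triple of sequences that extends given strings by zeros. -/
def ofPrefixes (t : Bool × List (Fin 3) × List (Fin 6)) : Bool × Seq 3 × Seq 6 :=
  (t.1, ofList t.2.1, ofList t.2.2)

theorem primrec_marked : Primrec₂ fun (t : Bool × List (Fin 3) × List (Fin 6)) n =>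
    marked (ofPrefixes t) n := by
  change Primrec₂ fun (t : Bool × List (Fin 3) × List (Fin 6)) n =>
    t.1 && nodeInTree (ofList t.2.1) n
  exact Primrec.and.comp (Primrec.fst.comp .fst)
    (primrec_nodeInTree.comp (Primrec.fst.comp (Primrec.snd.comp .fst)) .snd)

theorem primrec_snd_snd_ofPrefixes : Primrec₂ fun (t : Bool × List (Fin 3) × List (Fin 6)) n =>
    (ofPrefixes t).2.2 n :=
  (Primrec.list_getD 0).comp (Primrec.snd.comp (Primrec.snd.comp .fst)) .snd

theorem primrec_emit : Primrec fun v : Bool × Bool × Fin 6 => emit v.1 v.2.1 v.2.2 :=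
  Primrec.dom_finite _

theorem primrec_cut : Primrec₂ fun (t : Bool × List (Fin 3) × List (Fin 6)) n =>
    cut (ofPrefixes t) n := by
  let parent (L : List Bool) : Bool := L.getD ((L.length - 1) / 2) false
  refine Primrec.nat_strong_rec _ (g := fun t L => some (if L.length = 0 then false else
    parent L || decide (emit (marked (ofPrefixes t) L.length) (parent L)
      ((ofPrefixes t).2.2 (L.length - 1)) = 1))) ?_ ?_
  · have hlength : Primrec fun v : (Bool × List (Fin 3) × List (Fin 6)) × List Bool => v.2.length :=
      Primrec.list_length.comp .snd
    have hpred := Primrec.nat_sub.comp hlength (.const 1)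
    have hparent := (Primrec.list_getD false).comp .snd (Primrec.nat_div.comp hpred (.const 2))
    exact Primrec.option_some.comp (Primrec.ite (Primrec.eq.comp hlength (.const 0)) (.const false)
      (Primrec.or.comp hparent (PrimrecPred.decide (Primrec.eq.comp (primrec_emit.comp
        (.pair (primrec_marked.comp .fst hlength)
          (.pair hparent (primrec_snd_snd_ofPrefixes.comp .fst hpred)))) (.const 1)))))
  · rintro t (_ | n)
    · simp [cut]
    · have hparent : parent ((List.range (n + 1)).map (cut (ofPrefixes t))) =
          cut (ofPrefixes t) (n / 2) := by
        simp only [parent, List.length_map, List.length_range, Nat.add_sub_cancel]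
        exact getD_map_range _ (by omega) _
      simp only [hparent]
      rw [cut]
      simp

theorem primrec_couple : Primrec₂ fun (t : Bool × List (Fin 3) × List (Fin 6)) n =>
    couple (ofPrefixes t) n :=
  primrec_emit.comp (.pair (primrec_marked.comp .fst (Primrec.succ.comp .snd))
    (.pair (primrec_cut.comp .fst (Primrec.nat_div.comp .snd (.const 2)))
      primrec_snd_snd_ofPrefixes))

theorem isPrimrecNonexpansive_couple : IsPrimrecNonexpansive couple := by
  refine ⟨fun t => prefixOf (couple (ofPrefixes t)) t.2.1.length, ?_, fun p N => ?_⟩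
  · simp only [prefixOf_eq_map]
    exact Primrec.list_map (Primrec.list_range.comp (Primrec.list_length.comp
      (Primrec.fst.comp .snd))) primrec_couple
  · have hp : prefixes p N = prefixes (ofPrefixes (prefixes p N)) N :=
      prefixes_eq_iff.2 ⟨rfl, fun i hi => (ofList_prefixOf _ hi).symm,
        fun i hi => (ofList_prefixOf _ hi).symm⟩
    simpa [prefixes] using prefixOf_couple_congr hp

end CouplingComputability

section Randomness

theorem exists_random_code {x : Seq 3} (hx : x ∈ MLR (lebesgue 3)) (hne : (survivors x).Nonempty) :
    ∃ z ∈ MLR (lebesgue 3), survivors x = paths (codedTree z) := by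
  obtain ⟨z, hz⟩ := exists_paths_codedTree_eq (isClosed_survivors x) hne
  refine ⟨z, fun W hW hzW => ?_, hz.symm⟩
  obtain ⟨⟨c, z', r⟩, rfl, hzW', hrV⟩ := exists_eq_of_mem_MLR measurePreserving_couple
    isPrimrecNonexpansive_couple hx hW (isMLTest_tailTest (S := {4, 5}) (by decide))
  have hr : ¬ HasTailIn {4, 5} r := fun h =>
    hrV (Set.mem_iInter.2 (mem_openFamily_tailTest_of_hasTailIn h))
  obtain rfl : c = true := eq_true_of_nonempty_survivors_couple hr hne
  rw [survivors_couple_true hr] at hz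
  exact hzW' (paths_codedTree_injective hz ▸ hzW)

theorem exists_random_labeling {z : Seq 3} (hz : z ∈ MLR (lebesgue 3)) :
    ∃ x ∈ MLR (lebesgue 3), survivors x = paths (codedTree z) := by
  have hrandom : ∀ᵐ r ∂lebesgue 6, couple (true, z, r) ∈ MLR (lebesgue 3) := by
    refine ae_mem_MLR_of_mem_MLR measurePreserving_couple isPrimrecNonexpansive_couple ?_ hz
    simp [← NNReal.coe_eq_zero]
  obtain ⟨r, hx, hr⟩ := (hrandom.and ae_mem_MLR).exists
  exact ⟨couple (true, z, r), hx,
    survivors_couple_true (not_hasTailIn_of_mem_MLR (by decide) hr)⟩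

end Randomness

end RandomZeros

theorem mainTheorem1 :
    (∀ F : RandomZeros.Seq 2 →. RandomZeros.Seq 2, RandomZeros.IsRandomContinuous F →
      (RandomZeros.zeroSet F).Nonempty →
        RandomZeros.IsRandomClosedSet (RandomZeros.zeroSet F)) ∧
    (∀ C : Set (RandomZeros.Seq 2), RandomZeros.IsRandomClosedSet C →
      ∃ F : RandomZeros.Seq 2 →. RandomZeros.Seq 2, RandomZeros.IsRandomContinuous F ∧
        C = RandomZeros.zeroSet F) := by
  constructor
  · rintro _ ⟨-, x, hx, rfl⟩ hne
    rw [RandomZeros.zeroSet_codedFun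
      (RandomZeros.not_hasTailIn_of_mem_MLR (by decide) hx)] at hne ⊢
    obtain ⟨z, hz, hsurvivors⟩ := RandomZeros.exists_random_code hx hne
    exact ⟨hne, RandomZeros.isClosed_survivors x, z, hz, hsurvivors⟩
  · rintro _ ⟨-, -, z, hz, rfl⟩
    obtain ⟨x, hx, hsurvivors⟩ := RandomZeros.exists_random_labeling hz
    refine ⟨RandomZeros.codedFun x,
      ⟨RandomZeros.isContinuousPartial_codedFun x, x, hx, rfl⟩, ?_⟩
    rw [RandomZeros.zeroSet_codedFun
      (RandomZeros.not_hasTailIn_of_mem_MLR (by decide) hx), hsurvivors]
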